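/- An entire function $E$ is of Hermite--Biehler class if $|E(\bar z)|<|E(z)|$ for all $z$ in the open upper half-plane $\mathbb{C}^+$. Write $f^*(z)=\overline{f(\bar z)}$. Let $\mathcal H(E)$ be the de Branges space of all entire $f$ with $\int_{\mathbb R}|f(t)/E(t)|^2\,dt<\infty$ such that $f/E$ and $f^*/E$ are of bounded type in $\mathbb{C}^+$ (quotients of two bounded analytic functions) and of nonpositive mean type, where the mean type of $u$ is $\limsup_{y\to+\infty} y^{-1}\log|u(iy)|$. Its inner product is $\langle f,g\rangle_E=\int_{\mathbb R} f(t)\overline{g(t)}\,|E(t)|^{-2}\,dt$. Put $$K_E(w,z)=\frac{\overline{E(w)}E(z)-E(\bar w)E^*(z)}{2\pi i(\bar w-z)},$$ with the removable singularity at $z=\bar w$ filled in by continuity. Let $E,F$ be of Hermite--Biehler class. Then: 1. The maps $\mathcal I:\mathcal H(E)\to\mathcal H(EF)$, $f\mapsto fF$, and $\mathcal J:\mathcal H(F)\to\mathcal H(EF)$, $g\mapsto gE^*$, are well defined and preserve inner products. 2. The images of $\mathcal I$ and $\mathcal J$ are orthogonal: $\langle fF,\,gE^*\rangle_{EF}=0$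 for all $f\in\mathcal H(E)$ and $g\in\mathcal H(F)$. 3. Together the images span $\mathcal H(EF)$: a function $h$ belongs to $\mathcal H(EF)$ if and only if $h=fF+gE^*$ for a unique pair $f\in\mathcal H(E)$, $g\in\mathcal H(F)$. 4. $K_E$, $K_F$ and $K_{EF}$ are the reproducing kernels of $\mathcal H(E)$, $\mathcal H(F)$ and $\mathcal H(EF)$ (for $G\in\{E,F,EF\}$, every $w\in\mathbb C$ and every $f\in\mathcal H(G)$, one has $K_G(w,\cdot)\in\mathcal H(G)$ and $f(w)=\langle f,K_G(w,\cdot)\rangle_G$), and for every $w\in\mathbb C$ $$K_{EF}(w,\cdot)=\overline{F(w)}\,F\,K_E(w,\cdot)+E(\bar w)\,E^*\,K_F(w,\cdot).$$ -/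

import Mathlib

open scoped ComplexConjugate

noncomputable section

namespace DeBranges

/-- The open upper half-plane `ℂ⁺`. -/
def upperHalf : Set ℂ := {z | 0 < z.im}

/-- `E` is of Hermite-Biehler class: entire, with `|E(z̄)| < |E(z)|` in the open upper half-plane.
Real zeros are allowed. -/
def IsHermiteBiehler (E : ℂ → ℂ) : Prop :=
  Differentiable ℂ E ∧ ∀ z ∈ upperHalf, ‖E (conj z)‖ < ‖E z‖

/-- The function `f*(z) = conj (f (conj z))`. -/
def starFn (f : ℂ → ℂ) : ℂ → ℂ := fun z => conj (f (conj z))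

/-- `f` is analytic and of bounded type in the upper half-plane: a quotient `P / Q` of two bounded
analytic functions there (`Q` not identically zero; its zeros are cancelled by those of `P`). -/
def IsBoundedType (f : ℂ → ℂ) : Prop :=
  DifferentiableOn ℂ f upperHalf ∧
  ∃ P Q : ℂ → ℂ, DifferentiableOn ℂ P upperHalf ∧ DifferentiableOn ℂ Q upperHalf ∧
    (∃ C : ℝ, ∀ z ∈ upperHalf, ‖P z‖ ≤ C) ∧ (∃ C : ℝ, ∀ z ∈ upperHalf, ‖Q z‖ ≤ C) ∧
    (∃ z ∈ upperHalf, Q z ≠ 0) ∧ ∀ z ∈ upperHalf, f z * Q z = P z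

/-- Mean type `limsup_{y → +∞} log |f(iy)| / y` in the upper half-plane, an extended real
(with `log 0 = -∞`). -/
def meanType (f : ℂ → ℂ) : EReal :=
  Filter.limsup (fun y : ℝ => ENNReal.log ‖f (Complex.I * (y : ℂ))‖ₑ / (y : EReal)) Filter.atTop

/-- The de Branges space `H(E)`, as a set of entire functions. -/
def space (E : ℂ → ℂ) : Set (ℂ → ℂ) :=
  {f | Differentiable ℂ f ∧
    MeasureTheory.MemLp (fun t : ℝ => f (t : ℂ) / E (t : ℂ)) 2 MeasureTheory.volume ∧
    IsBoundedType (fun z => f z / E z) ∧ meanType (fun z => f z / E z) ≤ 0 ∧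
    IsBoundedType (fun z => starFn f z / E z) ∧ meanType (fun z => starFn f z / E z) ≤ 0}

/-- The inner product `⟨f, g⟩_E = ∫ f(t) conj(g(t)) / |E(t)|² dt` of `H(E)`,
linear in the first argument. -/
def ip (E f g : ℂ → ℂ) : ℂ :=
  ∫ t : ℝ, f (t : ℂ) * conj (g (t : ℂ)) / ((‖E (t : ℂ)‖ ^ 2 : ℝ) : ℂ)

/-- The numerator `conj(E(w)) E(z) - E(w̄) E*(z)` of the kernel; it vanishes at `z = w̄`. -/
def kernelNum (E : ℂ → ℂ) (w z : ℂ) : ℂ :=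
  conj (E w) * E z - E (conj w) * starFn E z

/-- The kernel `K_E(w, z) = (conj(E(w)) E(z) - E(w̄) E*(z)) / (2πi (w̄ - z))`, with the removable
singularity at `z = w̄` filled in by the limit. -/
def kernel (E : ℂ → ℂ) (w : ℂ) : ℂ → ℂ := fun z =>
  if z = conj w then -deriv (kernelNum E w) (conj w) / (2 * (Real.pi : ℂ) * Complex.I)
  else kernelNum E w z / (2 * (Real.pi : ℂ) * Complex.I * (conj w - z))

/-- `K` is the reproducing kernel of `H(E)`: `K(w, ·) ∈ H(E)` and `f(w) = ⟨f, K(w, ·)⟩_E` for all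
`w` and all `f ∈ H(E)`. -/
def IsReproducingKernel (E : ℂ → ℂ) (K : ℂ → ℂ → ℂ) : Prop :=
  ∀ w : ℂ, K w ∈ space E ∧ ∀ f ∈ space E, f w = ip E f (K w)

/-- The map `I : f ↦ f F`. -/
def mapI (F f : ℂ → ℂ) : ℂ → ℂ := fun z => f z * F z

/-- The map `J : g ↦ g E*`. -/
def mapJ (E g : ℂ → ℂ) : ℂ → ℂ := fun z => g z * starFn E z

end DeBranges

end

/-!
A function of bounded type in the upper half-plane grows at most like `exp (A (1 + |z|²) / Im z)`
(Harnack's inequality, after division by a Blaschke product). With square integrable boundary values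
and nonpositive mean type, this growth is enough for a Phragmén–Lindelöf argument which shows that
the function is the Cauchy integral of its boundary values. Applied to `f / E` and `f* / E`,
Cauchy's formula is the reproducing formula `f(w) = ⟨f, K_E(w, ·)⟩` for nonreal `w`; real `w` are
limits of nonreal ones.

The rest is Hilbert space geometry based on the algebraic identity
`K_{EF}(w, ·) = conj(F(w)) · F K_E(w, ·) + E(w̄) · E* K_F(w, ·)`. Evaluating `E* g` at `w ∈ ℂ⁺` by
this identity gives `E*(w) g(w) + F(w) ⟨E* g, F K_E(w, ·)⟩`, hence `E* g` is orthogonal to the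
functions `F K_E(w, ·)`, which span a dense subspace of `F H(E)`. An element of `H(EF)` orthogonal
to both images is orthogonal to every `K_{EF}(w, ·)`, so it vanishes; since both images are closed,
they span `H(EF)`.
-/

noncomputable section

namespace DeBranges

open Complex Metric Set Filter Topology MeasureTheory

/-! ### Growth of functions of bounded type -/

theorem harmonic_le_of_nonneg {h : ℂ → ℝ} {c w : ℂ} {ρ : ℝ}
    (hh : InnerProductSpace.HarmonicOnNhd h (closedBall c ρ))
    (h0 : ∀ z ∈ closedBall c ρ, 0 ≤ h z) (hw : w ∈ ball c ρ) :
    h w ≤ (ρ + ‖w - c‖) / (ρ - ‖w - c‖) * h c := by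
  have hρ : 0 < ρ := pos_of_mem_ball hw
  have hcont : ContinuousOn h (sphere c |ρ|) := fun z hz =>
    have hz' : z ∈ closedBall c ρ := sphere_subset_closedBall (by rwa [abs_of_pos hρ] at hz)
    (hh z hz').1.continuousAt.continuousWithinAt
  have poisson := hh.circleAverage_re_herglotzRieszKernel_smul hw
  have mean := InnerProductSpace.HarmonicOnNhd.circleAverage_eq (R := ρ) (by rwa [abs_of_pos hρ])
  rw [← mean, ← smul_eq_mul, ← Real.circleAverage_fun_smul, ← poisson]
  refine Real.circleAverage_mono ?_ hcont.circleIntegrable'.const_smul fun z hz => ?_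
  · exact (ContinuousOn.smul (Complex.continuous_re.comp_continuousOn
      (continuousOn_herglotzRieszKernel_sphere hw)) hcont).circleIntegrable'
  · rw [abs_of_pos hρ] at hz
    simp only [smul_eq_mul, Pi.smul_apply', Function.comp_apply, herglotzRieszKernel_def]
    exact mul_le_mul_of_nonneg_right (re_herglotzRieszKernel_le hz hw)
      (h0 z (sphere_subset_closedBall hz))

theorem exists_eq_prod_sub_pow_mul {f : ℂ → ℂ} {U : Set ℂ} {x : ℂ} (hf : AnalyticOnNhd ℂ f U)
    (hU : IsCompact U) (hUc : IsPreconnected U) (hx : U ∈ 𝓝 x) (hfx : f x ≠ 0) :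
    ∃ (S : Finset ℂ) (n : ℂ → ℕ) (g : ℂ → ℂ), ↑S ⊆ U ∧ AnalyticOnNhd ℂ g U ∧
      (∀ z ∈ U, g z ≠ 0) ∧ ∀ z ∈ U, f z = (∏ u ∈ S, (z - u) ^ n u) * g z := by
  have hxU : x ∈ U := mem_of_mem_nhds hx
  have hord : ∀ u : U, meromorphicOrderAt f u ≠ ⊤ := by
    intro u hu
    rw [(hf u u.2).meromorphicOrderAt_eq, ENat.map_eq_top_iff, analyticOrderAt_eq_top] at hu
    exact hfx (hf.eqOn_zero_of_preconnected_of_eventuallyEq_zero hUc u.2 hu hxU)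
  set D := MeromorphicOn.divisor f U
  have hfin : D.support.Finite := D.finiteSupport hU
  obtain ⟨g, hg, hg0, hfg⟩ := hf.meromorphicOn.extract_zeros_poles hord hfin
  have hD : ∀ u, 0 ≤ D u := fun u => MeromorphicOn.AnalyticOnNhd.divisor_nonneg hf u
  have hprod : (∏ᶠ u, (fun z : ℂ => z - u) ^ D u)
      = fun z => ∏ u ∈ hfin.toFinset, (z - u) ^ (D u).toNat := by
    rw [finprod_eq_prod_of_mulSupport_subset (s := hfin.toFinset)]
    · ext z
      rw [Finset.prod_apply]
      refine Finset.prod_congr rfl fun u _ => ?_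
      rw [Pi.pow_apply, ← zpow_natCast, Int.toNat_of_nonneg (hD u)]
    · intro u hu
      by_contra h
      have : D u = 0 := by simpa using h
      simp [this] at hu
  rw [hprod] at hfg
  refine ⟨hfin.toFinset, fun u => (D u).toNat, g,
    fun u hu => D.supportWithinDomain (by simpa using hu), hg, fun z hz => hg0 ⟨z, hz⟩, ?_⟩
  have han : AnalyticOnNhd ℂ (fun z => (∏ u ∈ hfin.toFinset, (z - u) ^ (D u).toNat) * g z) U :=
    fun z hz => (Finset.analyticAt_fun_prod _ fun u _ => by fun_prop).mul (hg z hz)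
  have hev : ∀ᶠ z in 𝓝[≠] x, f z = (∏ u ∈ hfin.toFinset, (z - u) ^ (D u).toNat) * g z := by
    have hm := mem_codiscreteWithin.1 hfg x hxU
    rw [disjoint_principal_right] at hm
    filter_upwards [hm, nhdsWithin_le_nhds hx] with z hz hzU
    by_contra hne
    exact hz ⟨hzU, fun h => hne (by simpa using h)⟩
  exact fun z hz => hf.eqOn_of_preconnected_of_frequently_eq han hUc hxU hev.frequently hz

/-- The numerator of the Blaschke factor of the disc of radius `R` with zero `u`. Replacing `z - u`
by it removes that zero without changing the modulus on the circle `‖z‖ = R`. -/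
def blaschkeNum (R : ℝ) (u z : ℂ) : ℂ := (R ^ 2 - conj u * z) / R

theorem norm_blaschkeNum_of_norm_eq {R : ℝ} (hR : 0 < R) (u : ℂ) {z : ℂ} (hz : ‖z‖ = R) :
    ‖blaschkeNum R u z‖ = ‖z - u‖ := by
  have h : (R : ℂ) ^ 2 - conj u * z = z * conj (z - u) := by
    rw [map_sub, mul_sub, mul_conj, normSq_eq_norm_sq, hz]; push_cast; ring
  rw [blaschkeNum, h, norm_div, norm_mul, RCLike.norm_conj, hz, norm_real,
    Real.norm_of_nonneg hR.le, mul_div_cancel_left₀ _ hR.ne']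

theorem blaschkeNum_ne_zero {R : ℝ} (hR : 0 < R) {u z : ℂ} (hu : ‖u‖ ≤ R) (hz : ‖z‖ < R) :
    blaschkeNum R u z ≠ 0 := by
  refine div_ne_zero (sub_ne_zero.2 fun h => ?_) (mod_cast hR.ne')
  have h2 := congrArg norm h
  rw [norm_mul, norm_pow, norm_real, Real.norm_of_nonneg hR.le, RCLike.norm_conj] at h2
  nlinarith [norm_nonneg u, norm_nonneg z]

theorem norm_blaschkeNum_zero {R : ℝ} (hR : 0 < R) (u : ℂ) : ‖blaschkeNum R u 0‖ = R := by
  rw [blaschkeNum, mul_zero, sub_zero, sq, mul_div_cancel_left₀ _ (mod_cast hR.ne'), norm_real,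
    Real.norm_of_nonneg hR.le]

theorem norm_le_of_analyticOnNhd_closedBall {f : ℂ → ℂ} {c : ℂ} {R C : ℝ} (hR : R ≠ 0)
    (hf : AnalyticOnNhd ℂ f (closedBall c R)) (hC : ∀ z ∈ sphere c R, ‖f z‖ ≤ C) {z : ℂ}
    (hz : z ∈ closedBall c R) : ‖f z‖ ≤ C := by
  rw [← closure_ball c hR] at hf hz
  exact norm_le_of_forall_mem_frontier_norm_le isBounded_ball hf.differentiableOn.diffContOnCl
    (by rwa [frontier_ball c hR]) hz

theorem exists_zero_free_norm_eq_on_sphere {q : ℂ → ℂ} {R : ℝ} (hR : 0 < R)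
    (hq : AnalyticOnNhd ℂ q (closedBall 0 R)) (hq0 : q 0 ≠ 0) :
    ∃ g : ℂ → ℂ, AnalyticOnNhd ℂ g (closedBall 0 R) ∧ (∀ z ∈ ball 0 R, g z ≠ 0) ∧
      (∀ z ∈ sphere 0 R, ‖g z‖ = ‖q z‖) ∧ ‖q 0‖ ≤ ‖g 0‖ := by
  obtain ⟨S, n, g, hS, hg, hg0, hqg⟩ := exists_eq_prod_sub_pow_mul hq (isCompact_closedBall 0 R)
    (convex_closedBall 0 R).isPreconnected (closedBall_mem_nhds 0 hR) hq0
  have hSR : ∀ u ∈ S, ‖u‖ ≤ R := fun u hu => by simpa using hS hu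
  refine ⟨fun z => (∏ u ∈ S, blaschkeNum R u z ^ n u) * g z, fun z hz => ?_, fun z hz => ?_,
    fun z hz => ?_, ?_⟩
  · refine (Finset.analyticAt_fun_prod _ fun u _ => ?_).mul (hg z hz)
    have : (R : ℂ) ≠ 0 := mod_cast hR.ne'
    unfold blaschkeNum
    fun_prop (disch := assumption)
  · refine mul_ne_zero (Finset.prod_ne_zero_iff.2 fun u hu => pow_ne_zero _ ?_)
      (hg0 z (ball_subset_closedBall hz))
    exact blaschkeNum_ne_zero hR (hSR u hu) (by simpa using hz)
  · simp only [hqg z (sphere_subset_closedBall hz), norm_mul, norm_prod, norm_pow,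
      norm_blaschkeNum_of_norm_eq hR _ (mem_sphere_zero_iff_norm.1 hz)]
  · simp only [hqg 0 (mem_closedBall_self hR.le), norm_mul, norm_prod, norm_pow,
      norm_blaschkeNum_zero hR, zero_sub, norm_neg]
    gcongr with u hu
    exact hSR u hu

/-- Dividing `q` by its Blaschke product makes `-log ‖q‖` a nonnegative harmonic function, to which
Harnack's inequality applies. -/
theorem norm_le_exp_of_norm_mul_le_one {q v : ℂ → ℂ} (hq : AnalyticOnNhd ℂ q (ball 0 1))
    (hv : AnalyticOnNhd ℂ v (ball 0 1)) (hq1 : ∀ z ∈ ball 0 1, ‖q z‖ ≤ 1)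
    (hvq : ∀ z ∈ ball 0 1, ‖v z * q z‖ ≤ 1) (hq0 : q 0 ≠ 0) {w : ℂ} (hw : w ∈ ball 0 1) :
    ‖v w‖ ≤ Real.exp (4 / (1 - ‖w‖) * -Real.log ‖q 0‖) := by
  have hw1 : ‖w‖ < 1 := by simpa using hw
  have hw0 := norm_nonneg w
  obtain ⟨ρ, hρ⟩ : ∃ ρ, ρ = (1 + ‖w‖) / 2 := ⟨_, rfl⟩
  obtain ⟨R, hρR, hR1⟩ : ∃ R, ρ < R ∧ R < 1 := exists_between (by linarith)
  have hR0 : 0 < R := by linarith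
  have hR : closedBall (0 : ℂ) R ⊆ ball 0 1 := closedBall_subset_ball hR1
  obtain ⟨g, hg, hg0, hgq, hq0g⟩ := exists_zero_free_norm_eq_on_sphere hR0 (hq.mono hR) hq0
  have hg1 : ∀ z ∈ closedBall 0 R, ‖g z‖ ≤ 1 := fun z hz =>
    norm_le_of_analyticOnNhd_closedBall hR0.ne' hg
      (fun z hz => hgq z hz ▸ hq1 z (hR (sphere_subset_closedBall hz))) hz
  have hvg : ∀ z ∈ closedBall 0 R, ‖v z * g z‖ ≤ 1 := fun z hz =>
    norm_le_of_analyticOnNhd_closedBall hR0.ne' ((hv.mono hR).mul hg) (fun z hz => by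
      rw [norm_mul, hgq z hz, ← norm_mul]
      exact hvq z (hR (sphere_subset_closedBall hz))) hz
  have hρb : closedBall (0 : ℂ) ρ ⊆ ball 0 R := closedBall_subset_ball hρR
  have hρc : closedBall (0 : ℂ) ρ ⊆ closedBall 0 R := hρb.trans ball_subset_closedBall
  have hwρ : w ∈ ball (0 : ℂ) ρ := by rw [mem_ball_zero_iff]; linarith
  have harnack := harmonic_le_of_nonneg (h := fun z => -Real.log ‖g z‖) (c := 0) (w := w) (ρ := ρ)
    (fun z hz => ((hg z (hρc hz)).harmonicAt_log_norm (hg0 z (hρb hz))).neg)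
    (fun z hz => neg_nonneg.2 (Real.log_nonpos (norm_nonneg _) (hg1 z (hρc hz)))) hwρ
  have hgw : 0 < ‖g w‖ := norm_pos_iff.2 (hg0 w (hρb (ball_subset_closedBall hwρ)))
  have hlog : -Real.log ‖g 0‖ ≤ -Real.log ‖q 0‖ :=
    neg_le_neg (Real.log_le_log (norm_pos_iff.2 hq0) hq0g)
  have hlog0 : 0 ≤ -Real.log ‖g 0‖ :=
    neg_nonneg.2 (Real.log_nonpos (norm_nonneg _) (hg1 0 (mem_closedBall_self hR0.le)))
  have hcoef : (ρ + ‖w‖) / (ρ - ‖w‖) ≤ 4 / (1 - ‖w‖) := by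
    rw [div_le_div_iff₀ (by linarith) (by linarith)]
    nlinarith
  rw [sub_zero] at harnack
  calc ‖v w‖ ≤ ‖g w‖⁻¹ := by
        rw [← one_div, le_div_iff₀ hgw, ← norm_mul]
        exact hvg w (hρc (ball_subset_closedBall hwρ))
    _ = Real.exp (-Real.log ‖g w‖) := by rw [Real.exp_neg, Real.exp_log hgw]
    _ ≤ Real.exp (4 / (1 - ‖w‖) * -Real.log ‖q 0‖) := by
        gcongr
        exact harnack.trans (mul_le_mul hcoef hlog hlog0 (div_nonneg zero_le_four (by linarith)))

theorem isOpen_upperHalf : IsOpen upperHalf := isOpen_lt continuous_const continuous_im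

theorem convex_upperHalf : Convex ℝ upperHalf := convex_halfSpace_im_gt 0

theorem sub_conj_ne_zero {z a : ℂ} (hz : z ∈ upperHalf) (ha : a ∈ upperHalf) :
    z - conj a ≠ 0 := fun h => by
  have h' : z.im + a.im = 0 := by simpa using congrArg im h
  exact (add_pos hz ha).ne' h'

/-- The Cayley transform of the upper half-plane onto the unit disc that vanishes at `a`. -/
def cayley (a z : ℂ) : ℂ := (z - a) / (z - conj a)

/-- The inverse of `cayley a`. -/
def cayleySymm (a ζ : ℂ) : ℂ := (a - conj a * ζ) / (1 - ζ)

theorem one_sub_ne_zero_of_mem_ball {ζ : ℂ} (hζ : ζ ∈ ball 0 1) : 1 - ζ ≠ 0 := fun h => by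
  simp [← sub_eq_zero.1 h] at hζ

theorem cayleySymm_zero (a : ℂ) : cayleySymm a 0 = a := by simp [cayleySymm]

theorem mapsTo_cayleySymm {a : ℂ} (ha : a ∈ upperHalf) :
    MapsTo (cayleySymm a) (ball 0 1) upperHalf := fun ζ hζ => by
  have him : (cayleySymm a ζ).im = a.im * (1 - ‖ζ‖ ^ 2) / ‖1 - ζ‖ ^ 2 := by
    simp only [cayleySymm, div_im, ← normSq_eq_norm_sq, normSq_apply, sub_re, sub_im, mul_re,
      mul_im, one_re, one_im, conj_re, conj_im]
    ring
  have hne : 0 < ‖1 - ζ‖ := norm_pos_iff.2 (one_sub_ne_zero_of_mem_ball hζ)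
  have hlt : 0 < 1 - ‖ζ‖ ^ 2 := by
    rw [mem_ball_zero_iff] at hζ
    nlinarith [norm_nonneg ζ]
  change 0 < (cayleySymm a ζ).im
  rw [him]
  exact div_pos (mul_pos ha hlt) (by positivity)

theorem differentiableOn_cayleySymm (a : ℂ) : DifferentiableOn ℂ (cayleySymm a) (ball 0 1) :=
  fun ζ hζ => by
    have := one_sub_ne_zero_of_mem_ball hζ
    unfold cayleySymm
    fun_prop (disch := assumption)

theorem cayleySymm_cayley {a z : ℂ} (ha : a ∈ upperHalf) (hz : z ∈ upperHalf) :
    cayleySymm a (cayley a z) = z := by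
  have h1 := sub_conj_ne_zero hz ha
  have h2 := sub_conj_ne_zero ha ha
  have h3 : 1 - cayley a z = (a - conj a) / (z - conj a) := by
    rw [cayley]; field_simp; ring
  rw [cayleySymm, h3, cayley]
  field_simp
  ring

theorem le_one_sub_norm_cayley {a z : ℂ} (ha : a ∈ upperHalf) (hz : z ∈ upperHalf) :
    2 * (z.im * a.im) / ‖z - conj a‖ ^ 2 ≤ 1 - ‖cayley a z‖ := by
  have hN : 0 < ‖z - conj a‖ := norm_pos_iff.2 (sub_conj_ne_zero hz ha)
  have hsq : 1 - ‖cayley a z‖ ^ 2 = 4 * (z.im * a.im) / ‖z - conj a‖ ^ 2 := by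
    rw [cayley, norm_div, div_pow, one_sub_div (by positivity)]
    congr 1
    simp only [← normSq_eq_norm_sq, normSq_apply, sub_re, sub_im, conj_re, conj_im]
    ring
  have htwice : 2 * (z.im * a.im) / ‖z - conj a‖ ^ 2 = (1 - ‖cayley a z‖ ^ 2) / 2 := by
    rw [hsq]; ring
  rw [htwice]
  nlinarith [sq_nonneg (1 - ‖cayley a z‖)]

theorem IsBoundedType.exists_growth {u : ℂ → ℂ} (hu : IsBoundedType u) :
    ∃ A : ℝ, 0 ≤ A ∧ ∀ z ∈ upperHalf, ‖u z‖ ≤ Real.exp (A * ((1 + ‖z‖ ^ 2) / z.im)) := by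
  obtain ⟨hud, P, Q, -, hQ, ⟨C₁, hC₁⟩, ⟨C₂, hC₂⟩, ⟨a, ha, hQa⟩, huQ⟩ := hu
  have ha0 : 0 < a.im := ha
  obtain ⟨C, hC, hC₁C, hC₂C⟩ : ∃ C : ℝ, 0 < C ∧ C₁ ≤ C ∧ C₂ ≤ C :=
    ⟨max 1 (max C₁ C₂), by positivity, by simp, by simp⟩
  have norm_div_le_one {x : ℂ} (hx : ‖x‖ ≤ C) : ‖x / C‖ ≤ 1 := by
    rwa [norm_div, norm_real, Real.norm_of_nonneg hC.le, div_le_one hC]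
  have analytic_comp {f : ℂ → ℂ} (hf : DifferentiableOn ℂ f upperHalf) :
      AnalyticOnNhd ℂ (f ∘ cayleySymm a) (ball 0 1) :=
    (hf.comp (differentiableOn_cayleySymm a) (mapsTo_cayleySymm ha)).analyticOnNhd isOpen_ball
  have hQ1 : ∀ z ∈ upperHalf, ‖Q z / C‖ ≤ 1 := fun z hz => norm_div_le_one ((hC₂ z hz).trans hC₂C)
  have huQ1 : ∀ z ∈ upperHalf, ‖u z * (Q z / C)‖ ≤ 1 := fun z hz => by
    rw [← mul_div_assoc, huQ z hz]
    exact norm_div_le_one ((hC₁ z hz).trans hC₁C)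
  obtain ⟨L, hL⟩ : ∃ L, L = -Real.log ‖Q a / C‖ := ⟨_, rfl⟩
  have hL0 : 0 ≤ L := hL ▸ neg_nonneg.2 (Real.log_nonpos (norm_nonneg _) (hQ1 a ha))
  refine ⟨4 * (1 + ‖a‖ ^ 2) * L / a.im, by positivity, fun z hz => ?_⟩
  have hz0 : 0 < z.im := hz
  have hN : 0 < ‖z - conj a‖ := norm_pos_iff.2 (sub_conj_ne_zero hz ha)
  have hgap := le_one_sub_norm_cayley ha hz
  have hgap0 : 0 < 2 * (z.im * a.im) / ‖z - conj a‖ ^ 2 := by positivity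
  have key := norm_le_exp_of_norm_mul_le_one (w := cayley a z)
    ((analytic_comp hQ).mul (analyticOnNhd_const (v := (C : ℂ)⁻¹))) (analytic_comp hud)
    (fun ζ hζ => hQ1 _ (mapsTo_cayleySymm ha hζ)) (fun ζ hζ => huQ1 _ (mapsTo_cayleySymm ha hζ))
    (by simpa [cayleySymm_zero] using ⟨hQa, hC.ne'⟩) (by rw [mem_ball_zero_iff]; linarith)
  simp only [Function.comp_apply, cayleySymm_cayley ha hz, cayleySymm_zero, ← div_eq_mul_inv,
    ← hL] at key
  have hnorm : ‖z - conj a‖ ^ 2 ≤ 2 * ((1 + ‖a‖ ^ 2) * (1 + ‖z‖ ^ 2)) := by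
    have htri := norm_sub_le z (conj a)
    rw [RCLike.norm_conj] at htri
    nlinarith [sq_nonneg (‖z‖ - ‖a‖), mul_nonneg (sq_nonneg ‖z‖) (sq_nonneg ‖a‖)]
  refine key.trans (Real.exp_le_exp.2 ?_)
  calc 4 / (1 - ‖cayley a z‖) * L ≤ 4 / (2 * (z.im * a.im) / ‖z - conj a‖ ^ 2) * L := by gcongr
    _ = 2 * L / (z.im * a.im) * ‖z - conj a‖ ^ 2 := by field_simp; ring
    _ ≤ 2 * L / (z.im * a.im) * (2 * ((1 + ‖a‖ ^ 2) * (1 + ‖z‖ ^ 2))) := by gcongr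
    _ = 4 * (1 + ‖a‖ ^ 2) * L / a.im * ((1 + ‖z‖ ^ 2) / z.im) := by field_simp; ring

/-! ### A Phragmén–Lindelöf principle in the half-plane -/

theorem le_of_forall_pow_mul_le {a M c K : ℝ} (hM : 0 < M) (hc : 0 < c)
    (h : ∀ n : ℕ, a ^ n * c ≤ M ^ n * K) : a ≤ M := by
  by_contra! hlt
  obtain ⟨n, hn⟩ := pow_unbounded_of_one_lt (K / c) ((one_lt_div hM).2 hlt)
  rw [div_pow, div_lt_div_iff₀ hc (by positivity)] at hn
  linarith [h n]

/-- The zeros of `p` on the frontier are exceptional points: as `f` stays bounded there, the usual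
maximum principle applies to every `f ^ n * p`. -/
theorem norm_le_of_forall_mem_frontier_of_ne_zero {Ω : Set ℂ} {f p : ℂ → ℂ} {M N : ℝ}
    (hΩ : Bornology.IsBounded Ω) (hf : DifferentiableOn ℂ f Ω) (hp : DiffContOnCl ℂ p Ω)
    (hfc : ∀ z ∈ closure Ω, p z ≠ 0 → ContinuousWithinAt f (closure Ω) z)
    (hN : ∀ z ∈ closure Ω, ‖f z‖ ≤ N) (hM : 0 < M)
    (hfM : ∀ z ∈ frontier Ω, p z ≠ 0 → ‖f z‖ ≤ M) {z : ℂ} (hz : z ∈ Ω) (hpz : p z ≠ 0) :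
    ‖f z‖ ≤ M := by
  obtain ⟨K, hK⟩ := hΩ.isCompact_closure.exists_bound_of_continuousOn hp.continuousOn
  have hcont (n : ℕ) : ContinuousOn (fun w => f w ^ n * p w) (closure Ω) := by
    intro w hw
    have hpw : ContinuousWithinAt p (closure Ω) w := hp.continuousOn w hw
    by_cases h0 : p w = 0
    · have hlim : Tendsto (fun v => N ^ n * ‖p v‖) (𝓝[closure Ω] w) (𝓝 0) := by
        simpa only [h0, norm_zero, mul_zero] using hpw.tendsto.norm.const_mul (N ^ n)
      simp only [ContinuousWithinAt, h0, mul_zero]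
      refine squeeze_zero_norm' ?_ hlim
      filter_upwards [self_mem_nhdsWithin] with v hv
      rw [norm_mul, norm_pow]
      gcongr
      exact hN v hv
    · exact ((hfc w hw h0).pow n).mul hpw
  refine le_of_forall_pow_mul_le (K := K) hM (norm_pos_iff.2 hpz) fun n => ?_
  rw [← norm_pow, ← norm_mul]
  refine norm_le_of_forall_mem_frontier_norm_le (f := fun w => f w ^ n * p w) hΩ
    ⟨(hf.pow n).mul hp.differentiableOn, hcont n⟩ (fun w hw => ?_) (subset_closure hz)
  have hpK := hK w (frontier_subset_closure hw)
  rw [norm_mul, norm_pow]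
  by_cases h0 : p w = 0
  · have : 0 ≤ K := (norm_nonneg _).trans hpK
    rw [h0, norm_zero, mul_zero]
    positivity
  · gcongr
    exact hfM w hw h0

/-- A function on the half-disc of radius `R` with nonnegative imaginary part, equal to `i / Im z`
on the arc `‖z‖ = R`; `R ^ 2` times it tends to `2 z` as `R → ∞`. -/
def halfDiscBarrier (R : ℝ) (z : ℂ) : ℂ := 2 * z / (R ^ 2 - z ^ 2)

theorem halfDiscBarrier_im_nonneg (R : ℝ) {z : ℂ} (hz : 0 ≤ z.im) :
    0 ≤ (halfDiscBarrier R z).im := by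
  have h : (halfDiscBarrier R z).im
      = 2 * z.im * (R ^ 2 + normSq z) / normSq (R ^ 2 - z ^ 2) := by
    simp only [halfDiscBarrier, div_im, normSq_apply, sub_re, sub_im, mul_re, mul_im, sq,
      ofReal_re, ofReal_im, re_ofNat, im_ofNat]
    ring
  have := normSq_nonneg z
  have := normSq_nonneg ((R : ℂ) ^ 2 - z ^ 2)
  rw [h]
  positivity

theorem halfDiscBarrier_of_norm_eq {R : ℝ} {z : ℂ} (hz : ‖z‖ = R) (hz0 : z.im ≠ 0) :
    halfDiscBarrier R z = I / z.im := by
  have hz' : z ≠ 0 := by rintro rfl; simp at hz0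
  have him : (z.im : ℂ) ≠ 0 := mod_cast hz0
  have h : (R : ℂ) ^ 2 - z ^ 2 = -(2 * I * z.im * z) := by
    rw [← hz, ← conj_mul', sq, ← sub_mul, ← neg_sub, sub_conj]; push_cast; ring
  rw [halfDiscBarrier, h]
  field_simp
  linear_combination -I_sq

theorem differentiableAt_halfDiscBarrier {R : ℝ} {z : ℂ} (hz : (R : ℂ) ^ 2 - z ^ 2 ≠ 0) :
    DifferentiableAt ℂ (halfDiscBarrier R) z := by
  unfold halfDiscBarrier
  fun_prop (disch := assumption)

theorem tendsto_sq_mul_halfDiscBarrier (z : ℂ) :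
    Tendsto (fun R : ℝ => (R : ℂ) ^ 2 * halfDiscBarrier R z) atTop (𝓝 (2 * z)) := by
  have h : ContinuousAt (fun r : ℝ => 2 * z / (1 - ((r : ℂ) * z) ^ 2)) 0 := by
    have : (1 : ℂ) - (((0 : ℝ) : ℂ) * z) ^ 2 ≠ 0 := by simp
    fun_prop (disch := assumption)
  have h' := h.tendsto.comp tendsto_inv_atTop_zero
  simp only [ofReal_zero, zero_mul, ne_eq, OfNat.ofNat_ne_zero, not_false_eq_true, zero_pow,
    sub_zero, div_one] at h'
  refine h'.congr' ?_
  filter_upwards [eventually_ne_atTop 0] with R hR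
  have hR' : (R : ℂ) ≠ 0 := mod_cast hR
  have h2 : (1 : ℂ) - (((R⁻¹ : ℝ) : ℂ) * z) ^ 2 = (R ^ 2 - z ^ 2) / R ^ 2 := by
    push_cast; field_simp
  rw [Function.comp_apply, h2, halfDiscBarrier, div_div_eq_mul_div, mul_div_assoc', mul_comm]

theorem closure_upperHalf : closure upperHalf = {z | 0 ≤ z.im} := closure_setOfPred_lt_im 0

theorem sq_sub_sq_ne_zero_of_mem_upperHalf (R : ℝ) {z : ℂ} (hz : z ∈ upperHalf) :
    (R : ℂ) ^ 2 - z ^ 2 ≠ 0 := by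
  have hz0 : 0 < z.im := hz
  rw [sq_sub_sq]
  refine mul_ne_zero (fun h => hz0.ne' ?_) (fun h => hz0.ne' ?_) <;> simpa using congrArg im h

theorem norm_exp_mul_halfDiscBarrier_mul_I (a R : ℝ) (z : ℂ) :
    ‖exp (a * halfDiscBarrier R z * I)‖ = Real.exp (-(a * (halfDiscBarrier R z).im)) := by
  rw [norm_exp, mul_I_re, im_ofReal_mul]

theorem norm_eq_of_mem_frontier_ball_inter_upperHalf {R : ℝ} {z : ℂ}
    (hz : z ∈ frontier (ball 0 R ∩ upperHalf)) (hz0 : z ∈ upperHalf) : ‖z‖ = R := by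
  rw [(isOpen_ball.inter isOpen_upperHalf).frontier_eq] at hz
  have hle : z ∈ closedBall 0 R :=
    closure_ball_subset_closedBall (closure_mono inter_subset_left hz.1)
  rw [mem_closedBall_zero_iff] at hle
  exact hle.eq_of_not_lt fun hlt => hz.2 ⟨mem_ball_zero_iff.2 hlt, hz0⟩

theorem growth_le_halfDiscBarrier {A R : ℝ} (hA : 0 ≤ A) (hR : 1 ≤ R) {z : ℂ}
    (hz : z ∈ upperHalf) (hzR : ‖z‖ = R) :
    A * ((1 + ‖z‖ ^ 2) / z.im) ≤ 2 * A * R ^ 2 * (halfDiscBarrier R z).im := by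
  have hz0 : 0 < z.im := hz
  have him : (halfDiscBarrier R z).im = 1 / z.im := by
    rw [halfDiscBarrier_of_norm_eq hzR hz0.ne', div_ofReal_im, I_im]
  rw [him, hzR, mul_one_div, ← mul_div_assoc]
  gcongr ?_ / _
  nlinarith [mul_nonneg hA (sub_nonneg.2 (one_le_pow₀ (n := 2) hR))]

theorem norm_le_of_growth_of_norm_lt {U : ℂ → ℂ} {A M R : ℝ} (hU : DiffContOnCl ℂ U upperHalf)
    (hA : 0 ≤ A) (hM : 1 ≤ M) (hreal : ∀ t : ℝ, ‖U t‖ ≤ M)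
    (hgr : ∀ z ∈ upperHalf, ‖U z‖ ≤ Real.exp (A * ((1 + ‖z‖ ^ 2) / z.im))) (hR : 1 ≤ R)
    {z : ℂ} (hz : z ∈ upperHalf) (hzR : ‖z‖ < R) :
    ‖U z‖ ≤ M * Real.exp (2 * A * R ^ 2 * (halfDiscBarrier R z).im) := by
  obtain ⟨a, ha⟩ : ∃ a, a = 2 * A * R ^ 2 := ⟨_, rfl⟩
  have ha0 : 0 ≤ a := by rw [ha]; positivity
  obtain ⟨e, he⟩ : ∃ e, e = fun z => exp (a * halfDiscBarrier R z * I) := ⟨_, rfl⟩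
  have norm_e (w : ℂ) : ‖e w‖ = Real.exp (-(a * (halfDiscBarrier R w).im)) := by
    rw [he, norm_exp_mul_halfDiscBarrier_mul_I]
  have norm_mul_e_le {w : ℂ} (hw : 0 ≤ w.im) : ‖U w * e w‖ ≤ ‖U w‖ := by
    rw [norm_mul, norm_e]
    exact mul_le_of_le_one_right (norm_nonneg _)
      (Real.exp_le_one_iff.2 (neg_nonpos.2 (mul_nonneg ha0 (halfDiscBarrier_im_nonneg R hw))))
  have differentiableAt_e {w : ℂ} (hw : (R : ℂ) ^ 2 - w ^ 2 ≠ 0) : DifferentiableAt ℂ e w := by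
    rw [he]
    exact (((differentiableAt_halfDiscBarrier hw).const_mul _).mul_const I).cexp
  obtain ⟨Ω, hΩ⟩ : ∃ Ω, Ω = ball (0 : ℂ) R ∩ upperHalf := ⟨_, rfl⟩
  have hΩb : Bornology.IsBounded Ω := hΩ ▸ isBounded_ball.subset inter_subset_left
  have hUΩ : DiffContOnCl ℂ U Ω := hU.mono (hΩ ▸ inter_subset_right)
  have hΩim : ∀ w ∈ closure Ω, 0 ≤ w.im := fun w hw =>
    closure_upperHalf.subset (closure_mono (hΩ ▸ inter_subset_right) hw)
  obtain ⟨N, hN⟩ := hΩb.isCompact_closure.exists_bound_of_continuousOn hUΩ.continuousOn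
  have key : ‖U z * e z‖ ≤ M := by
    refine norm_le_of_forall_mem_frontier_of_ne_zero (p := fun w => R ^ 2 - w ^ 2) hΩb
      (hUΩ.differentiableOn.mul fun w hw => ?_) (Differentiable.diffContOnCl (by fun_prop))
      (fun w hw hw0 => ?_) (fun w hw => (norm_mul_e_le (hΩim w hw)).trans (hN w hw))
      (by linarith) (fun w hw _ => ?_) (hΩ ▸ ⟨mem_ball_zero_iff.2 hzR, hz⟩)
      (sq_sub_sq_ne_zero_of_mem_upperHalf R hz)
    · have hw' : w ∈ upperHalf := (hΩ ▸ hw : w ∈ ball 0 R ∩ upperHalf).2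
      exact (differentiableAt_e (sq_sub_sq_ne_zero_of_mem_upperHalf R hw')).differentiableWithinAt
    · exact (hUΩ.continuousOn w hw).mul (differentiableAt_e hw0).continuousAt.continuousWithinAt
    · rcases (hΩim w (frontier_subset_closure hw)).eq_or_lt with h0 | h0
      · have hwr : (w.re : ℂ) = w := Complex.ext rfl h0
        exact (norm_mul_e_le h0.le).trans (hwr ▸ hreal w.re)
      · have hwR := norm_eq_of_mem_frontier_ball_inter_upperHalf (hΩ ▸ hw) h0
        rw [Pi.mul_apply, norm_mul, norm_e, Real.exp_neg, ← div_eq_mul_inv,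
          div_le_iff₀ (Real.exp_pos _)]
        refine ((hgr w h0).trans ?_).trans (le_mul_of_one_le_left (Real.exp_pos _).le hM)
        exact Real.exp_le_exp.2 (ha ▸ growth_le_halfDiscBarrier hA hR h0 hwR)
  rwa [norm_mul, norm_e, Real.exp_neg, ← div_eq_mul_inv, div_le_iff₀ (Real.exp_pos _), ha] at key

theorem norm_le_exp_im_of_growth {U : ℂ → ℂ} {A M : ℝ} (hU : DiffContOnCl ℂ U upperHalf)
    (hA : 0 ≤ A) (hM : 1 ≤ M) (hreal : ∀ t : ℝ, ‖U t‖ ≤ M)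
    (hgr : ∀ z ∈ upperHalf, ‖U z‖ ≤ Real.exp (A * ((1 + ‖z‖ ^ 2) / z.im)))
    {z : ℂ} (hz : 0 ≤ z.im) : ‖U z‖ ≤ M * Real.exp (4 * A * z.im) := by
  rcases hz.eq_or_lt with h0 | hz
  · have hzr : z = (z.re : ℂ) := Complex.ext rfl h0.symm
    simpa [← h0, ← hzr] using hreal z.re
  have hlim : Tendsto (fun R : ℝ => M * Real.exp (2 * A * R ^ 2 * (halfDiscBarrier R z).im)) atTop
      (𝓝 (M * Real.exp (4 * A * z.im))) := by
    have him := ((continuous_im.tendsto _).comp (tendsto_sq_mul_halfDiscBarrier z)).const_mul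
      (2 * A)
    have hval : 2 * A * (2 * z).im = 4 * A * z.im := by simp; ring
    rw [hval] at him
    refine ((Real.continuous_exp.tendsto _).comp (him.congr fun R => ?_)).const_mul M
    rw [Function.comp_apply, ← ofReal_pow, im_ofReal_mul]
    ring
  refine ge_of_tendsto hlim ?_
  filter_upwards [eventually_ge_atTop 1, eventually_gt_atTop ‖z‖] with R h1 h2
  exact norm_le_of_growth_of_norm_lt hU hA hM hreal hgr h1 hz h2

/-! ### The Cauchy integral over the real line -/

theorem norm_integral_real_le_of_norm_le {G : ℂ → ℂ} {C R : ℝ} (hR : 0 ≤ R)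
    (hc : ContinuousOn G {z | 0 ≤ z.im}) (hd : DifferentiableOn ℂ G upperHalf)
    (hG : ∀ z : ℂ, 0 ≤ z.im → R ≤ ‖z‖ → ‖G z‖ ≤ C) :
    ‖∫ x : ℝ in -R..R, G x‖ ≤ 4 * C * R := by
  have hrect := integral_boundary_rect_eq_zero_of_continuousOn_of_differentiableOn G
    (-R : ℂ) (R + R * I) (hc.mono fun z hz => by simpa [hR] using hz.2.1)
    (hd.mono fun z hz => by simpa [upperHalf, hR] using hz.2.1)
  simp only [neg_re, ofReal_re, add_re, mul_re, I_re, mul_zero, ofReal_im, I_im, mul_one, sub_zero,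
    add_zero, neg_im, neg_zero, add_im, mul_im, zero_add, ofReal_zero, zero_mul, ofReal_neg]
    at hrect
  have htop : ‖∫ x : ℝ in -R..R, G (x + R * I)‖ ≤ C * |R - -R| :=
    intervalIntegral.norm_integral_le_of_norm_le_const fun x _ => hG _ (by simpa using hR) <| by
      simpa [abs_of_nonneg hR] using abs_im_le_norm ((x : ℂ) + R * I)
  have hside : ∀ σ : ℝ, |σ| = R → ‖∫ y : ℝ in (0 : ℝ)..R, G (σ + y * I)‖ ≤ C * |R - 0| :=
    fun σ hσ => intervalIntegral.norm_integral_le_of_norm_le_const fun y hy => hG _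
      (by simpa using ((uIoc_of_le hR).subset hy).1.le) <| by
      simpa [hσ] using abs_re_le_norm ((σ : ℂ) + y * I)
  have hright := hside R (abs_of_nonneg hR)
  have hleft := hside (-R) (by rw [abs_neg, abs_of_nonneg hR])
  rw [ofReal_neg] at hleft
  rw [sub_zero, abs_of_nonneg hR] at hright hleft
  rw [show |R - -R| = 2 * R by rw [abs_of_nonneg (by linarith)]; ring] at htop
  calc ‖∫ x : ℝ in -R..R, G x‖
      = ‖(∫ x : ℝ in -R..R, G (x + R * I)) - I * (∫ y : ℝ in (0 : ℝ)..R, G (R + y * I)) +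
          I * ∫ y : ℝ in (0 : ℝ)..R, G (-R + y * I)‖ := by
        congr 1
        simp only [smul_eq_mul] at hrect
        linear_combination hrect
    _ ≤ C * (2 * R) + C * R + C * R := by
        refine (norm_add_le _ _).trans (add_le_add ((norm_sub_le _ _).trans ?_) ?_)
        · simpa using add_le_add htop hright
        · simpa using hleft
    _ = 4 * C * R := by ring

theorem integral_real_eq_zero_of_norm_le {G : ℂ → ℂ} {K R₀ : ℝ}
    (hc : ContinuousOn G {z | 0 ≤ z.im}) (hd : DifferentiableOn ℂ G upperHalf)
    (hi : Integrable fun t : ℝ => G t)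
    (hG : ∀ z : ℂ, 0 ≤ z.im → R₀ ≤ ‖z‖ → ‖G z‖ ≤ K / ‖z‖ ^ 2) :
    ∫ t : ℝ, G t = 0 := by
  have hlim := intervalIntegral_tendsto_integral hi tendsto_neg_atTop_atBot tendsto_id
  have hK : Tendsto (fun R : ℝ => 4 * |K| / R) atTop (𝓝 0) :=
    tendsto_const_nhds.div_atTop tendsto_id
  refine tendsto_nhds_unique hlim (squeeze_zero_norm' ?_ hK)
  filter_upwards [eventually_ge_atTop R₀, eventually_gt_atTop 0] with R hR hR0
  refine (norm_integral_real_le_of_norm_le (C := |K| / R ^ 2) hR0.le hc hd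
    fun z hz hRz => ?_).trans_eq (by field_simp)
  calc ‖G z‖ ≤ K / ‖z‖ ^ 2 := hG z hz (hR.trans hRz)
    _ ≤ |K| / R ^ 2 := by gcongr; exact le_abs_self K

theorem norm_inv_sub_mul_inv_sub_le {a b w : ℂ} (hw : 0 < ‖w‖) (ha : 2 * ‖a‖ ≤ ‖w‖)
    (hb : 2 * ‖b‖ ≤ ‖w‖) : ‖(w - a)⁻¹ * (w - b)⁻¹‖ ≤ 4 / ‖w‖ ^ 2 := by
  have ha' : ‖w‖ / 2 ≤ ‖w - a‖ := by linarith [norm_sub_norm_le w a]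
  have hb' : ‖w‖ / 2 ≤ ‖w - b‖ := by linarith [norm_sub_norm_le w b]
  rw [norm_mul, norm_inv, norm_inv]
  calc ‖w - a‖⁻¹ * ‖w - b‖⁻¹ ≤ (‖w‖ / 2)⁻¹ * (‖w‖ / 2)⁻¹ := by gcongr
    _ = 4 / ‖w‖ ^ 2 := by field_simp; norm_num

/-- The Cauchy integral `∫ φ(t) / (t - z) dt` over the real line, without the factor `1 / (2πi)`. -/
def cauchyInt (φ : ℝ → ℂ) (z : ℂ) : ℂ := ∫ t : ℝ, φ t / ((t : ℂ) - z)

theorem abs_im_le_norm_ofReal_sub (z : ℂ) (t : ℝ) : |z.im| ≤ ‖(t : ℂ) - z‖ := by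
  simpa using abs_im_le_norm ((t : ℂ) - z)

theorem ofReal_sub_ne_zero {z : ℂ} (hz : z.im ≠ 0) (t : ℝ) : (t : ℂ) - z ≠ 0 :=
  norm_pos_iff.1 ((abs_pos.2 hz).trans_le (abs_im_le_norm_ofReal_sub z t))

theorem inv_normSq_ofReal_sub {z : ℂ} (hz : z.im ≠ 0) (t : ℝ) :
    (normSq ((t : ℂ) - z))⁻¹ =
      Real.pi / |z.im| * ProbabilityTheory.cauchyPDFReal z.re ‖z.im‖₊ t := by
  have hsq : normSq ((t : ℂ) - z) = (t - z.re) ^ 2 + |z.im| ^ 2 := by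
    rw [sq_abs, normSq_apply, sub_re, sub_im, ofReal_re, ofReal_im]
    ring
  have hz' : |z.im| ≠ 0 := abs_ne_zero.2 hz
  rw [ProbabilityTheory.cauchyPDFReal_def, coe_nnnorm, Real.norm_eq_abs, hsq]
  field_simp

theorem integrable_inv_normSq {z : ℂ} (hz : z.im ≠ 0) :
    Integrable fun t : ℝ => (normSq ((t : ℂ) - z))⁻¹ := by
  simp_rw [inv_normSq_ofReal_sub hz]
  exact (ProbabilityTheory.integrable_cauchyPDFReal z.re).const_mul _

theorem integral_inv_normSq {z : ℂ} (hz : z.im ≠ 0) :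
    ∫ t : ℝ, (normSq ((t : ℂ) - z))⁻¹ = Real.pi / |z.im| := by
  simp_rw [inv_normSq_ofReal_sub hz]
  rw [integral_const_mul,
    ProbabilityTheory.integral_cauchyPDFReal_eq_one _ (nnnorm_ne_zero_iff.2 hz), mul_one]

theorem memLp_inv_ofReal_sub {z : ℂ} (hz : z.im ≠ 0) :
    MemLp (fun t : ℝ => ((t : ℂ) - z)⁻¹) 2 := by
  have hm : Continuous fun t : ℝ => ((t : ℂ) - z)⁻¹ := .inv₀ (by fun_prop) (ofReal_sub_ne_zero hz)
  rw [memLp_two_iff_integrable_sq_norm hm.aestronglyMeasurable]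
  simpa only [norm_inv, inv_pow, normSq_eq_norm_sq] using integrable_inv_normSq hz

theorem integrable_div_ofReal_sub {φ : ℝ → ℂ} (hφ : MemLp φ 2) {z : ℂ} (hz : z.im ≠ 0) :
    Integrable fun t : ℝ => φ t / ((t : ℂ) - z) := by
  simpa only [div_eq_mul_inv] using! hφ.integrable_mul (memLp_inv_ofReal_sub hz)

theorem norm_div_le_sq_add (a b : ℂ) : ‖a / b‖ ≤ ‖a‖ ^ 2 + (normSq b)⁻¹ := by
  rw [div_eq_mul_inv, norm_mul, normSq_eq_norm_sq, ← inv_pow, ← norm_inv]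
  nlinarith [two_mul_le_add_sq ‖a‖ ‖b⁻¹‖, mul_nonneg (norm_nonneg a) (norm_nonneg b⁻¹)]

theorem integral_norm_div_ofReal_sub_le {φ : ℝ → ℂ} (hφ : MemLp φ 2) {z : ℂ} (hz : z.im ≠ 0) :
    ∫ t : ℝ, ‖φ t / ((t : ℂ) - z)‖ ≤ (∫ t : ℝ, ‖φ t‖ ^ 2) + Real.pi / |z.im| := by
  have hφ2 : Integrable fun t : ℝ => ‖φ t‖ ^ 2 := hφ.integrable_norm_pow two_ne_zero
  rw [← integral_inv_normSq hz, ← integral_add hφ2 (integrable_inv_normSq hz)]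
  exact integral_mono (integrable_div_ofReal_sub hφ hz).norm (hφ2.add (integrable_inv_normSq hz))
    fun t => norm_div_le_sq_add _ _

theorem norm_cauchyInt_le {φ : ℝ → ℂ} (hφ : MemLp φ 2) {z : ℂ} (hz : z.im ≠ 0) :
    ‖cauchyInt φ z‖ ≤ (∫ t : ℝ, ‖φ t‖ ^ 2) + Real.pi / |z.im| :=
  (norm_integral_le_integral_norm _).trans (integral_norm_div_ofReal_sub_le hφ hz)

theorem half_norm_ofReal_sub_le {w z : ℂ} (hw : ‖w - z‖ ≤ |z.im| / 2) (t : ℝ) :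
    ‖(t : ℂ) - z‖ / 2 ≤ ‖(t : ℂ) - w‖ := by
  have htri : ‖(t : ℂ) - z‖ ≤ ‖(t : ℂ) - w‖ + ‖w - z‖ := norm_sub_le_norm_sub_add_norm_sub _ _ _
  linarith [abs_im_le_norm_ofReal_sub z t]

theorem hasDerivAt_div_ofReal_sub (c : ℂ) {t : ℝ} {w : ℂ} (h : (t : ℂ) - w ≠ 0) :
    HasDerivAt (fun w : ℂ => c / ((t : ℂ) - w)) (c / ((t : ℂ) - w) ^ 2) w := by
  have := ((hasDerivAt_id w).const_sub (t : ℂ)).inv h |>.const_mul c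
  convert! this using 1
  simp only [id, neg_neg]
  ring

theorem differentiableAt_cauchyInt {φ : ℝ → ℂ} (hφ : MemLp φ 2) {z : ℂ} (hz : z.im ≠ 0) :
    DifferentiableAt ℂ (cauchyInt φ) z := by
  have hz' : 0 < |z.im| := abs_pos.2 hz
  have hnear : ∀ w ∈ ball z (|z.im| / 2), ∀ t : ℝ, ‖(t : ℂ) - z‖ / 2 ≤ ‖(t : ℂ) - w‖ :=
    fun w hw => half_norm_ofReal_sub_le (by simpa [dist_eq_norm] using (mem_ball.1 hw).le)
  refine (hasDerivAt_integral_of_dominated_loc_of_deriv_le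
    (F := fun (w : ℂ) (t : ℝ) => φ t / ((t : ℂ) - w))
    (F' := fun (w : ℂ) (t : ℝ) => φ t / ((t : ℂ) - w) ^ 2) (μ := volume)
    (bound := fun t => 4 / |z.im| * ‖φ t / ((t : ℂ) - z)‖) (ball_mem_nhds z (half_pos hz'))
    (Eventually.of_forall fun w => ?_) (integrable_div_ofReal_sub hφ hz) ?_
    (Eventually.of_forall fun t w hw => ?_) ((integrable_div_ofReal_sub hφ hz).norm.const_mul _)
    (Eventually.of_forall fun t w hw => ?_)).2.differentiableAt
  · exact hφ.1.div₀ (by fun_prop : Continuous fun t : ℝ => (t : ℂ) - w).aestronglyMeasurable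
  · exact hφ.1.div₀ (by fun_prop : Continuous fun t : ℝ => ((t : ℂ) - z) ^ 2).aestronglyMeasurable
  · have hn := hnear w hw t
    have him := abs_im_le_norm_ofReal_sub z t
    have hpos : 0 < ‖(t : ℂ) - z‖ := hz'.trans_le him
    rw [norm_div, norm_div, norm_pow]
    calc ‖φ t‖ / ‖(t : ℂ) - w‖ ^ 2 ≤ ‖φ t‖ / (|z.im| * ‖(t : ℂ) - z‖ / 4) := by
          gcongr
          nlinarith
      _ = 4 / |z.im| * (‖φ t‖ / ‖(t : ℂ) - z‖) := by field_simp
  · refine hasDerivAt_div_ofReal_sub _ (norm_pos_iff.1 ?_)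
    linarith [hnear w hw t, abs_im_le_norm_ofReal_sub z t]

/-! ### Cauchy's formula for bounded functions -/

theorem sub_ne_zero_of_im_nonneg_of_im_neg {w z : ℂ} (hw : 0 ≤ w.im) (hz : z.im < 0) :
    w - z ≠ 0 := by
  rintro h
  rw [sub_eq_zero.1 h] at hw
  exact hw.not_gt hz

theorem tendsto_cauchyInt_atBot {φ : ℝ → ℂ} (hi : Integrable fun t : ℝ => φ t / ((t : ℂ) - -I)) :
    Tendsto (fun y : ℝ => cauchyInt φ (-(y * I))) atTop (𝓝 0) := by
  rw [← integral_zero ℝ ℂ (μ := volume)]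
  refine tendsto_integral_filter_of_dominated_convergence (fun t => ‖φ t / ((t : ℂ) - -I)‖)
    ?_ ?_ hi.norm (Eventually.of_forall fun t => ?_)
  · refine Eventually.of_forall fun y => ?_
    have hφ : AEStronglyMeasurable φ volume := by
      refine (hi.1.mul (by fun_prop : Continuous fun t : ℝ => (t : ℂ) - -I).aestronglyMeasurable)
        |>.congr (Eventually.of_forall fun t => ?_)
      exact div_mul_cancel₀ _ (ofReal_sub_ne_zero (by simp) t)
    exact hφ.div₀ (by fun_prop : Continuous fun t : ℝ => (t : ℂ) - -(y * I)).aestronglyMeasurable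
  · filter_upwards [eventually_ge_atTop 1] with y hy
    refine Eventually.of_forall fun t => ?_
    have hpos := norm_pos_iff.2 (ofReal_sub_ne_zero (z := -I) (by simp) t)
    rw [norm_div, norm_div]
    gcongr
    refine le_of_sq_le_sq ?_ (norm_nonneg _)
    rw [← normSq_eq_norm_sq, ← normSq_eq_norm_sq]
    simp only [normSq_apply, sub_neg_eq_add, add_re, ofReal_re, I_re, add_im, ofReal_im, I_im,
      mul_re, mul_im]
    nlinarith
  · have hy : Tendsto (fun y : ℝ => ‖(t : ℂ) - -(y * I)‖) atTop atTop := by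
      refine tendsto_atTop_mono (fun y => ?_) tendsto_abs_atTop_atTop
      simpa using abs_im_le_norm_ofReal_sub (-(y * I)) t
    exact squeeze_zero_norm (fun y => (norm_div _ _).le) (tendsto_const_nhds.div_atTop hy)

theorem cauchyInt_eq_cauchyInt_of_bounded {g : ℂ → ℂ} {M : ℝ}
    (hg : ContinuousOn g {z | 0 ≤ z.im})
    (hgd : DifferentiableOn ℂ g upperHalf) (hM : ∀ z : ℂ, 0 ≤ z.im → ‖g z‖ ≤ M)
    (hi : ∀ z : ℂ, z.im ≠ 0 → Integrable fun t : ℝ => g t / ((t : ℂ) - z)) {z w : ℂ}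
    (hz : z.im < 0) (hw : w.im < 0) :
    cauchyInt (fun t => g t) z = cauchyInt (fun t => g t) w := by
  have hne : ∀ x : ℂ, 0 ≤ x.im → ∀ a : ℂ, a.im < 0 → x - a ≠ 0 := fun x hx a =>
    sub_ne_zero_of_im_nonneg_of_im_neg hx
  have hdiff : ∀ x : ℂ, 0 ≤ x.im →
      g x * ((z - w) * ((x - z)⁻¹ * (x - w)⁻¹)) = g x / (x - z) - g x / (x - w) := fun x hx => by
    have := hne x hx z hz
    have := hne x hx w hw
    field_simp
    ring
  have hzero := integral_real_eq_zero_of_norm_le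
    (G := fun x => g x * ((z - w) * ((x - z)⁻¹ * (x - w)⁻¹))) (K := M * ‖z - w‖ * 4)
    (R₀ := 2 * ‖z‖ + 2 * ‖w‖ + 1)
    (hg.mul <| continuousOn_const.mul <| ContinuousOn.mul
      (.inv₀ (by fun_prop) fun x hx => hne x hx z hz)
      (.inv₀ (by fun_prop) fun x hx => hne x hx w hw))
    (hgd.mul <| DifferentiableOn.const_mul (DifferentiableOn.mul
      (.inv (by fun_prop) fun x hx => hne x (le_of_lt hx) z hz)
      (.inv (by fun_prop) fun x hx => hne x (le_of_lt hx) w hw)) _)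
    (by
      simp_rw [fun t : ℝ => hdiff t (ofReal_im t).ge]
      exact (hi z hz.ne).sub (hi w hw.ne))
    (fun x hx hxR => by
      have := norm_nonneg z
      have := norm_nonneg w
      rw [norm_mul, norm_mul, mul_assoc, mul_div_assoc, mul_div_assoc]
      gcongr
      · exact (norm_nonneg _).trans (hM x hx)
      · exact hM x hx
      · exact norm_inv_sub_mul_inv_sub_le (by linarith) (by linarith) (by linarith))
  simp_rw [fun t : ℝ => hdiff t (ofReal_im t).ge] at hzero
  rwa [integral_sub (hi z hz.ne) (hi w hw.ne), sub_eq_zero] at hzero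

theorem cauchyInt_eq_zero_of_bounded {g : ℂ → ℂ} {M : ℝ} (hg : ContinuousOn g {z | 0 ≤ z.im})
    (hgd : DifferentiableOn ℂ g upperHalf) (hM : ∀ z : ℂ, 0 ≤ z.im → ‖g z‖ ≤ M)
    (hi : ∀ z : ℂ, z.im ≠ 0 → Integrable fun t : ℝ => g t / ((t : ℂ) - z)) {z : ℂ}
    (hz : z.im < 0) : cauchyInt (fun t => g t) z = 0 := by
  refine tendsto_nhds_unique (tendsto_const_nhds.congr' ?_)
    (tendsto_cauchyInt_atBot (hi (-I) (by simp)))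
  filter_upwards [eventually_gt_atTop 0] with y hy
  exact cauchyInt_eq_cauchyInt_of_bounded hg hgd hM hi hz (by simpa using hy)

theorem sub_conj_mul_inv_mul_inv (z : ℂ) (t : ℝ) :
    (z - conj z) * (((t : ℂ) - z)⁻¹ * ((t : ℂ) - conj z)⁻¹) =
      2 * z.im * I * ((normSq ((t : ℂ) - z))⁻¹ : ℝ) := by
  rw [ofReal_inv, normSq_eq_conj_mul_self, map_sub, conj_ofReal, sub_conj, mul_inv]
  push_cast
  ring

theorem integrable_sub_conj_mul_inv_mul_inv {z : ℂ} (hz : z.im ≠ 0) :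
    Integrable fun t : ℝ => (z - conj z) * (((t : ℂ) - z)⁻¹ * ((t : ℂ) - conj z)⁻¹) := by
  simp_rw [sub_conj_mul_inv_mul_inv]
  exact (integrable_inv_normSq hz).ofReal.const_mul _

theorem integral_sub_conj_mul_inv_mul_inv {z : ℂ} (hz : 0 < z.im) :
    ∫ t : ℝ, (z - conj z) * (((t : ℂ) - z)⁻¹ * ((t : ℂ) - conj z)⁻¹) = 2 * Real.pi * I := by
  have him : (z.im : ℂ) ≠ 0 := ofReal_ne_zero.2 hz.ne'
  simp_rw [sub_conj_mul_inv_mul_inv]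
  rw [integral_const_mul, integral_complex_ofReal, integral_inv_normSq hz.ne', abs_of_pos hz]
  push_cast
  field_simp

theorem mul_dslope_of_ne (g : ℂ → ℂ) {z x : ℂ} (hx : x ≠ z) :
    (z - conj z) * (x - conj z)⁻¹ * dslope g z x =
      (z - conj z) * (g x - g z) * ((x - z)⁻¹ * (x - conj z)⁻¹) := by
  rw [dslope_of_ne _ hx, slope_def_field]
  ring

/-- The factor `(z - z̄) / (w - z̄)` makes the difference quotient of `g` decay like `|w|⁻²`. -/
theorem integral_mul_dslope_eq_zero {g : ℂ → ℂ} {M : ℝ} (hg : ContinuousOn g {z | 0 ≤ z.im})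
    (hgd : DifferentiableOn ℂ g upperHalf) (hM : ∀ z : ℂ, 0 ≤ z.im → ‖g z‖ ≤ M) {z : ℂ}
    (hz : 0 < z.im)
    (hi : Integrable fun t : ℝ => (z - conj z) * ((t : ℂ) - conj z)⁻¹ * dslope g z t) :
    ∫ t : ℝ, (z - conj z) * ((t : ℂ) - conj z)⁻¹ * dslope g z t = 0 := by
  have hne : ∀ x : ℂ, 0 ≤ x.im → x - conj z ≠ 0 := fun x hx =>
    sub_ne_zero_of_im_nonneg_of_im_neg hx (by simpa using hz)
  have hsub : upperHalf ⊆ {w : ℂ | 0 ≤ w.im} := fun w (hw : 0 < w.im) => le_of_lt hw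
  have hnhds : upperHalf ∈ 𝓝 z := isOpen_upperHalf.mem_nhds hz
  refine integral_real_eq_zero_of_norm_le
    (G := fun x => (z - conj z) * (x - conj z)⁻¹ * dslope g z x)
    (K := ‖z - conj z‖ * (M + M) * 4) (R₀ := 2 * ‖z‖ + 1)
    ((continuousOn_const.mul (.inv₀ (by fun_prop) hne)).mul
      ((continuousOn_dslope (mem_of_superset hnhds hsub)).2 ⟨hg, hgd.differentiableAt hnhds⟩))
    ((DifferentiableOn.const_mul (.inv (by fun_prop) fun x hx => hne x (le_of_lt hx)) _).mul
      ((Complex.differentiableOn_dslope hnhds).2 hgd)) hi fun x hx hxR => ?_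
  have hz0 := norm_nonneg z
  have hdiff : ‖g x - g z‖ ≤ M + M := (norm_sub_le _ _).trans (add_le_add (hM x hx) (hM z hz.le))
  have hinv := norm_inv_sub_mul_inv_sub_le (a := z) (b := conj z) (w := x) (by linarith)
    (by linarith) (by rw [RCLike.norm_conj]; linarith)
  rw [mul_dslope_of_ne g (by rintro rfl; linarith), norm_mul, norm_mul, mul_div_assoc]
  exact mul_le_mul (by gcongr) hinv (norm_nonneg _)
    (mul_nonneg (norm_nonneg _) ((norm_nonneg _).trans hdiff))

theorem cauchyInt_sub_cauchyInt_conj_of_bounded {g : ℂ → ℂ} {M : ℝ}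
    (hg : ContinuousOn g {z | 0 ≤ z.im})
    (hgd : DifferentiableOn ℂ g upperHalf) (hM : ∀ z : ℂ, 0 ≤ z.im → ‖g z‖ ≤ M)
    (hi : ∀ z : ℂ, z.im ≠ 0 → Integrable fun t : ℝ => g t / ((t : ℂ) - z)) {z : ℂ}
    (hz : 0 < z.im) :
    cauchyInt (fun t => g t) z - cauchyInt (fun t => g t) (conj z) = 2 * Real.pi * I * g z := by
  have hz' : (conj z).im ≠ 0 := by simpa using hz.ne'
  have hreal : ∀ t : ℝ, (z - conj z) * ((t : ℂ) - conj z)⁻¹ * dslope g z t =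
      g t / ((t : ℂ) - z) - g t / ((t : ℂ) - conj z) -
        g z * ((z - conj z) * (((t : ℂ) - z)⁻¹ * ((t : ℂ) - conj z)⁻¹)) := fun t => by
    have h1 := ofReal_sub_ne_zero hz.ne' t
    have h2 := ofReal_sub_ne_zero hz' t
    rw [mul_dslope_of_ne g (sub_ne_zero.1 h1)]
    field_simp
    ring
  have hig : Integrable fun t : ℝ => g t / ((t : ℂ) - z) - g t / ((t : ℂ) - conj z) :=
    (hi z hz.ne').sub (hi _ hz')
  have hiP := (integrable_sub_conj_mul_inv_mul_inv hz.ne').const_mul (g z)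
  have hzero := integral_mul_dslope_eq_zero hg hgd hM hz
    ((hig.sub hiP).congr (Eventually.of_forall fun t => (hreal t).symm))
  simp_rw [hreal] at hzero
  rw [integral_sub hig hiP, integral_sub (hi z hz.ne') (hi _ hz'), integral_const_mul,
    integral_sub_conj_mul_inv_mul_inv hz, sub_eq_zero] at hzero
  rw [cauchyInt, cauchyInt, hzero, mul_comm]

theorem cauchyInt_eq_of_bounded {g : ℂ → ℂ} {M : ℝ} (hg : ContinuousOn g {z | 0 ≤ z.im})
    (hgd : DifferentiableOn ℂ g upperHalf) (hM : ∀ z : ℂ, 0 ≤ z.im → ‖g z‖ ≤ M)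
    (hi : ∀ z : ℂ, z.im ≠ 0 → Integrable fun t : ℝ => g t / ((t : ℂ) - z)) {z : ℂ}
    (hz : 0 < z.im) : cauchyInt (fun t => g t) z = 2 * Real.pi * I * g z := by
  rw [← cauchyInt_sub_cauchyInt_conj_of_bounded hg hgd hM hi hz,
    cauchyInt_eq_zero_of_bounded hg hgd hM hi (z := conj z) (by simpa using hz), sub_zero]

/-! ### Cauchy's formula for functions with square integrable boundary values -/

/-- The average `∫₀ʰ u(z + s) ds` along a horizontal segment. It turns square integrable boundary
values into bounded ones. -/
def movingAverage (h : ℝ) (u : ℂ → ℂ) (z : ℂ) : ℂ :=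
  ∫ s in (0 : ℝ)..h, u (z + s)

theorem continuous_movingAverage (h : ℝ) {u : ℂ → ℂ} (hu : Continuous u) :
    Continuous (movingAverage h u) := by
  refine intervalIntegral.continuous_parametric_intervalIntegral_of_continuous' ?_ 0 h
  simp only [Function.uncurry_def]
  fun_prop

theorem add_ofReal_mem_upperHalf_of_mem_closedBall {z w : ℂ} (hz : z ∈ upperHalf)
    (hw : w ∈ closedBall z (z.im / 2)) (s : ℝ) : w + s ∈ upperHalf := by
  have hz' : 0 < z.im := hz
  have him := (abs_im_le_norm (w - z)).trans (mem_closedBall_iff_norm.1 hw)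
  rw [sub_im] at him
  change 0 < (w + s).im
  rw [add_im, ofReal_im, add_zero]
  linarith [(abs_le.1 him).1]

theorem differentiableOn_movingAverage (h : ℝ) {u : ℂ → ℂ} (hu : Continuous u)
    (hud : DifferentiableOn ℂ u upperHalf) :
    DifferentiableOn ℂ (movingAverage h u) upperHalf := by
  intro z hz
  have hz' : 0 < z.im := hz
  have hmem : ∀ w ∈ closedBall z (z.im / 2), ∀ s : ℝ, w + s ∈ upperHalf := fun w hw s =>
    add_ofReal_mem_upperHalf_of_mem_closedBall hz hw s
  have hderiv : ContinuousOn (deriv u) upperHalf :=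
    (hud.analyticOnNhd isOpen_upperHalf).deriv.continuousOn
  have hderiv₂ : ContinuousOn (fun p : ℂ × ℝ => deriv u (p.1 + p.2))
      (closedBall z (z.im / 2) ×ˢ uIcc 0 h) :=
    hderiv.comp (by fun_prop) fun p hp => hmem _ hp.1 _
  obtain ⟨C, hC⟩ := ((isCompact_closedBall z (z.im / 2)).prod
    isCompact_uIcc).exists_bound_of_continuousOn hderiv₂
  refine (intervalIntegral.hasDerivAt_integral_of_dominated_loc_of_deriv_le
    (F := fun (w : ℂ) (s : ℝ) => u (w + s)) (F' := fun (w : ℂ) (s : ℝ) => deriv u (w + s))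
    (bound := fun _ => C) (closedBall_mem_nhds z (by positivity))
    (Eventually.of_forall fun w => Continuous.aestronglyMeasurable (by fun_prop))
    (Continuous.intervalIntegrable (by fun_prop) _ _) (Continuous.aestronglyMeasurable ?_)
    (Eventually.of_forall fun s hs w hw => hC (w, s) ⟨hw, uIoc_subset_uIcc hs⟩)
    intervalIntegrable_const
    (Eventually.of_forall fun s _ w hw => ?_)).2.differentiableAt.differentiableWithinAt
  · exact hderiv.comp_continuous (by fun_prop) fun s =>
      hmem z (mem_closedBall_self (by positivity)) s
  · have hdiff := hud.differentiableAt (isOpen_upperHalf.mem_nhds (hmem w hw s))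
    exact hdiff.hasDerivAt.comp_add_const w s

theorem norm_movingAverage_le {h C : ℝ} {u : ℂ → ℂ} {z : ℂ} (hh : 0 ≤ h)
    (hC : ∀ s ∈ Icc 0 h, ‖u (z + (s : ℝ))‖ ≤ C) : ‖movingAverage h u z‖ ≤ C * h := by
  have := intervalIntegral.norm_integral_le_of_norm_le_const (a := 0) (b := h)
    (f := fun s : ℝ => u (z + s)) (C := C) fun s hs => by
      rw [uIoc_of_le hh] at hs
      exact hC s (Ioc_subset_Icc_self hs)
  rwa [sub_zero, abs_of_nonneg hh] at this

theorem norm_movingAverage_ofReal_le {h : ℝ} {u : ℂ → ℂ} (hh : 0 ≤ h) (hu : Continuous u)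
    (hL : MemLp (fun t : ℝ => u t) 2) (t : ℝ) :
    ‖movingAverage h u t‖ ≤ (∫ x : ℝ, ‖u x‖ ^ 2) + h := by
  have hi : Integrable (fun s : ℝ => ‖u (t + s)‖ ^ 2) := by
    simpa using (hL.integrable_norm_pow two_ne_zero).comp_add_left t
  calc ‖movingAverage h u t‖ ≤ ∫ s in (0 : ℝ)..h, (‖u (t + s)‖ ^ 2 + 1) :=
        intervalIntegral.norm_integral_le_of_norm_le hh
          (Eventually.of_forall fun s _ => by nlinarith [sq_nonneg (‖u (t + s)‖ - 1)])
          (Continuous.intervalIntegrable (by fun_prop) _ _)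
    _ = (∫ s in (0 : ℝ)..h, ‖u (t + s)‖ ^ 2) + h := by
        rw [intervalIntegral.integral_add (Continuous.intervalIntegrable (by fun_prop) _ _)
          intervalIntegrable_const, intervalIntegral.integral_const, sub_zero, smul_eq_mul, mul_one]
    _ ≤ (∫ s : ℝ, ‖u (t + s)‖ ^ 2) + h := by
        rw [intervalIntegral.integral_of_le hh]
        exact add_le_add_left
          (setIntegral_le_integral hi (Eventually.of_forall fun s => by positivity)) h
    _ = (∫ x : ℝ, ‖u x‖ ^ 2) + h := by
        simpa using integral_add_left_eq_self (μ := volume) (fun x : ℝ => ‖u x‖ ^ 2) t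

theorem integral_comp_add_div (u : ℂ → ℂ) (z : ℂ) (s : ℝ) :
    ∫ t : ℝ, u (t + s) / ((t : ℂ) - z) = cauchyInt (fun t => u t) (z + s) := by
  rw [cauchyInt, ← integral_add_right_eq_self (fun t : ℝ => u t / ((t : ℂ) - (z + s))) s]
  simp only [ofReal_add, add_sub_add_right_eq_sub]

theorem integrable_prod_comp_add_div {u : ℂ → ℂ} (hu : Continuous u)
    (hL : MemLp (fun t : ℝ => u t) 2) (h : ℝ) {z : ℂ} (hz : z.im ≠ 0) :
    Integrable (Function.uncurry fun s t : ℝ => u (t + s) / ((t : ℂ) - z))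
      ((volume.restrict (Ioc 0 h)).prod volume) := by
  have hLs : ∀ s : ℝ, MemLp (fun t : ℝ => u (t + s)) 2 := fun s => by
    simpa [Function.comp_def] using
      hL.comp_measurePreserving (measurePreserving_add_right volume s)
  have hsq : ∀ s : ℝ, ∫ t : ℝ, ‖u (t + s)‖ ^ 2 = ∫ t : ℝ, ‖u t‖ ^ 2 := fun s => by
    simpa using integral_add_right_eq_self (μ := volume) (fun x : ℝ => ‖u x‖ ^ 2) s
  have hm : Continuous (Function.uncurry fun s t : ℝ => u (t + s) / ((t : ℂ) - z)) := by
    simp only [Function.uncurry_def]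
    exact Continuous.div (by fun_prop) (by fun_prop) fun p => ofReal_sub_ne_zero hz p.2
  rw [integrable_prod_iff hm.aestronglyMeasurable]
  refine ⟨Eventually.of_forall fun s => integrable_div_ofReal_sub (hLs s) hz,
    Integrable.mono' (integrable_const ((∫ t : ℝ, ‖u t‖ ^ 2) + Real.pi / |z.im|))
      hm.aestronglyMeasurable.norm.integral_prod_right' (Eventually.of_forall fun s => ?_)⟩
  rw [Real.norm_of_nonneg (integral_nonneg fun t => norm_nonneg _), ← hsq s]
  exact integral_norm_div_ofReal_sub_le (hLs s) hz

section
variable {u : ℂ → ℂ} {h : ℝ} (hh : 0 ≤ h) (hu : Continuous u) (hL : MemLp (fun t : ℝ => u t) 2)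
  {z : ℂ} (hz : z.im ≠ 0)
include hh

theorem movingAverage_div (u : ℂ → ℂ) (z : ℂ) (t : ℝ) :
    movingAverage h u t / ((t : ℂ) - z) = ∫ s in Ioc 0 h, u (t + s) / ((t : ℂ) - z) := by
  rw [movingAverage, intervalIntegral.integral_of_le hh, integral_div]

include hu hL hz

theorem integrable_movingAverage_div :
    Integrable fun t : ℝ => movingAverage h u t / ((t : ℂ) - z) := by
  simp_rw [movingAverage_div hh]
  exact (integrable_prod_comp_add_div hu hL h hz).integral_prod_right

theorem cauchyInt_movingAverage :
    cauchyInt (fun t => movingAverage h u t) z =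
      ∫ s in (0 : ℝ)..h, cauchyInt (fun t => u t) (z + s) := by
  rw [cauchyInt, intervalIntegral.integral_of_le hh]
  simp_rw [movingAverage_div hh, ← integral_comp_add_div]
  exact (integral_integral_swap (integrable_prod_comp_add_div hu hL h hz)).symm

end

theorem eq_of_forall_integral_eq {φ ψ : ℝ → ℂ} (hφ : Continuous φ) (hψ : Continuous ψ)
    (h : ∀ x ∈ Icc (0 : ℝ) 1, ∫ s in (0 : ℝ)..x, φ s = ∫ s in (0 : ℝ)..x, ψ s) : φ 0 = ψ 0 := by
  have h1 := (hφ.integral_hasStrictDerivAt 0 0).hasDerivAt.hasDerivWithinAt (s := Icc 0 1)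
  have h2 := (hψ.integral_hasStrictDerivAt 0 0).hasDerivAt.hasDerivWithinAt (s := Icc 0 1)
  exact (uniqueDiffOn_Icc one_pos 0 (by simp)).eq_deriv _ h1 (h2.congr h (h 0 (by simp)))

/-- Since moving averages commute with the Cauchy integral, differentiating at `h = 0` recovers
Cauchy's formula. -/
theorem cauchyInt_eq_of_movingAverage {u : ℂ → ℂ} (hu : Continuous u)
    (hL : MemLp (fun t : ℝ => u t) 2) {z c : ℂ} (hz : z.im ≠ 0)
    (h : ∀ x ∈ Icc (0 : ℝ) 1,
      cauchyInt (fun t => movingAverage x u t) z = c * movingAverage x u z) :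
    cauchyInt (fun t => u t) z = c * u z := by
  have hcont : Continuous fun s : ℝ => cauchyInt (fun t => u t) (z + s) :=
    continuous_iff_continuousAt.2 fun s =>
      (differentiableAt_cauchyInt hL (by simpa using hz)).continuousAt.comp
        (f := fun s : ℝ => z + s) (by fun_prop)
  simpa using eq_of_forall_integral_eq hcont (ψ := fun s : ℝ => c * u (z + s)) (by fun_prop)
    fun x hx => by
      rw [intervalIntegral.integral_const_mul, ← cauchyInt_movingAverage hx.1 hu hL hz]
      exact h x hx

section
variable {u : ℂ → ℂ} (hu : Continuous u) (hud : DifferentiableOn ℂ u upperHalf)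
  (hL : MemLp (fun t : ℝ => u t) 2)
  (hb : ∀ h ∈ Icc (0 : ℝ) 1, ∃ M : ℝ, ∀ z : ℂ, 0 ≤ z.im → ‖movingAverage h u z‖ ≤ M)
include hu hud hL hb

theorem cauchyInt_eq_of_bounded_movingAverage {z : ℂ} (hz : 0 < z.im) :
    cauchyInt (fun t => u t) z = 2 * Real.pi * I * u z := by
  refine cauchyInt_eq_of_movingAverage hu hL hz.ne' fun h hh => ?_
  obtain ⟨M, hM⟩ := hb h hh
  exact cauchyInt_eq_of_bounded (continuous_movingAverage h hu).continuousOn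
    (differentiableOn_movingAverage h hu hud) hM
    (fun w hw => integrable_movingAverage_div hh.1 hu hL hw) hz

theorem cauchyInt_eq_zero_of_bounded_movingAverage {z : ℂ} (hz : z.im < 0) :
    cauchyInt (fun t => u t) z = 0 := by
  rw [cauchyInt_eq_of_movingAverage (c := 0) hu hL hz.ne fun h hh => ?_, zero_mul]
  obtain ⟨M, hM⟩ := hb h hh
  rw [zero_mul]
  exact cauchyInt_eq_zero_of_bounded (continuous_movingAverage h hu).continuousOn
    (differentiableOn_movingAverage h hu hud) hM
    (fun w hw => integrable_movingAverage_div hh.1 hu hL hw) hz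

end

theorem norm_exp_mul_I_mul (c : ℝ) (z : ℂ) : ‖exp (c * I * z)‖ = Real.exp (-(c * z.im)) := by
  simp [norm_exp]

theorem one_add_norm_add_sq_le {w s : ℂ} (hs : ‖s‖ ≤ 1) :
    1 + ‖w + s‖ ^ 2 ≤ 4 * (1 + ‖w‖ ^ 2) := by
  nlinarith [norm_add_le w s, norm_nonneg w, norm_nonneg (w + s), sq_nonneg (‖w‖ - 1)]

theorem norm_movingAverage_le_exp {u : ℂ → ℂ} {A c : ℝ} (hu : Continuous u)
    (hud : DifferentiableOn ℂ u upperHalf) (hL : MemLp (fun t : ℝ => u t) 2) (hA : 0 ≤ A)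
    (hgr : ∀ z ∈ upperHalf, ‖u z‖ ≤ Real.exp (A * ((1 + ‖z‖ ^ 2) / z.im) - c * z.im)) {h : ℝ}
    (hh : h ∈ Icc (0 : ℝ) 1) {z : ℂ} (hz : 0 ≤ z.im) :
    ‖movingAverage h u z‖ ≤ ((∫ x : ℝ, ‖u x‖ ^ 2) + 1) * Real.exp ((16 * A - c) * z.im) := by
  have hI : 0 ≤ ∫ x : ℝ, ‖u x‖ ^ 2 := integral_nonneg fun x => by positivity
  set U : ℂ → ℂ := fun z => exp ((-c : ℝ) * I * z) * movingAverage h u z with hU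
  have hUn : ∀ z, ‖U z‖ = Real.exp (c * z.im) * ‖movingAverage h u z‖ := fun z => by
    rw [hU, norm_mul, norm_exp_mul_I_mul, neg_mul, neg_neg]
  have hUd : DifferentiableOn ℂ U upperHalf :=
    DifferentiableOn.mul (by fun_prop) (differentiableOn_movingAverage h hu hud)
  have hUc : Continuous U := by
    have := continuous_movingAverage h hu
    fun_prop
  have hUreal : ∀ t : ℝ, ‖U t‖ ≤ (∫ x : ℝ, ‖u x‖ ^ 2) + 1 := fun t => by
    rw [hUn, ofReal_im, mul_zero, Real.exp_zero, one_mul]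
    exact (norm_movingAverage_ofReal_le hh.1 hu hL t).trans (by linarith [hh.2])
  have hUgr : ∀ w ∈ upperHalf, ‖U w‖ ≤ Real.exp (4 * A * ((1 + ‖w‖ ^ 2) / w.im)) := by
    intro w hw
    have hw' : 0 < w.im := hw
    have hshift := norm_movingAverage_le (u := u) (z := w) hh.1
      (C := Real.exp (4 * A * ((1 + ‖w‖ ^ 2) / w.im) - c * w.im)) fun s hs => by
        have him : (w + s).im = w.im := by simp
        have hs1 : ‖(s : ℂ)‖ ≤ 1 := by
          rw [norm_real, Real.norm_of_nonneg hs.1]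
          exact hs.2.trans hh.2
        refine (hgr (w + s) (by change 0 < (w + s).im; rwa [him])).trans (Real.exp_le_exp.2 ?_)
        rw [him, mul_comm 4 A, mul_assoc A, ← mul_div_assoc 4]
        gcongr
        exact one_add_norm_add_sq_le hs1
    rw [hUn, mul_comm, ← le_div_iff₀ (Real.exp_pos _), ← Real.exp_sub]
    exact hshift.trans (mul_le_of_le_one_right (Real.exp_pos _).le hh.2)
  have hmain := norm_le_exp_im_of_growth ⟨hUd, hUc.continuousOn⟩ (by positivity : 0 ≤ 4 * A)
    (by linarith) hUreal hUgr hz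
  rw [hUn, mul_comm, ← le_div_iff₀ (Real.exp_pos _), mul_div_assoc, ← Real.exp_sub] at hmain
  convert! hmain using 3
  ring

theorem right_half_plane_norm_le_of_eventually_le_exp {f : ℂ → ℂ} {C : ℝ} {z : ℂ}
    (hd : DiffContOnCl ℂ f {z | 0 < z.re})
    (hexp : ∃ c < (2 : ℝ), ∃ B,
      f =O[Bornology.cobounded ℂ ⊓ 𝓟 {z | 0 < z.re}] fun z => Real.exp (B * ‖z‖ ^ c))
    (hre : ∀ ε > 0, ∀ᶠ x : ℝ in atTop, ‖f x‖ ≤ Real.exp (ε * x))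
    (him : ∀ x : ℝ, ‖f (x * I)‖ ≤ C) (hz : 0 ≤ z.re) : ‖f z‖ ≤ C := by
  have hdamp : ∀ ε : ℝ, ∀ w, ‖f w * exp (-ε * w)‖ = ‖f w‖ * Real.exp (-(ε * w.re)) :=
    fun ε w => by simp [norm_exp]
  have hbound : ∀ ε : ℝ, 0 < ε → ‖f z * exp (-ε * z)‖ ≤ C := by
    intro ε hε
    refine PhragmenLindelof.right_half_plane_of_bounded_on_real
      (f := fun w => f w * exp (-ε * w)) (hd.smul (Differentiable.diffContOnCl (by fun_prop))) ?_ ?_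
      (fun x => by rw [hdamp]; simpa using him x) hz
    · obtain ⟨c, hc, B, hB⟩ := hexp
      refine ⟨c, hc, B, (Asymptotics.IsBigO.of_bound 1 ?_).trans hB⟩
      refine (eventually_principal.2 fun (w : ℂ) (hw : 0 < w.re) => ?_).filter_mono inf_le_right
      rw [hdamp, one_mul]
      exact mul_le_of_le_one_right (norm_nonneg _) (Real.exp_le_one_iff.2 (by nlinarith))
    · refine ⟨1, eventually_map.2 ?_⟩
      filter_upwards [hre ε hε] with x hx
      rw [hdamp, ofReal_re, Real.exp_neg, ← div_eq_mul_inv, div_le_one (Real.exp_pos _)]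
      exact hx
  have hlim : Tendsto (fun ε : ℝ => ‖f z * exp (-ε * z)‖) (𝓝[>] 0) (𝓝 ‖f z‖) := by
    have hcont : Continuous fun ε : ℝ => ‖f z * exp (-ε * z)‖ := by fun_prop
    simpa using (hcont.tendsto 0).mono_left (nhdsWithin_le_nhds (s := Ioi 0))
  exact le_of_tendsto hlim (eventually_nhdsWithin_of_forall hbound)

theorem norm_le_of_exponential_type {u : ℂ → ℂ} {K c : ℝ} (hc : 0 ≤ c)
    (hud : DifferentiableOn ℂ u upperHalf)
    (hb : ∀ z : ℂ, 1 ≤ z.im → ‖u z‖ ≤ K * Real.exp (c * z.im))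
    (hax : ∀ ε > 0, ∀ᶠ y : ℝ in atTop, ‖u (I * y)‖ ≤ Real.exp (ε * y)) {z : ℂ} (hz : 1 ≤ z.im) :
    ‖u z‖ ≤ K * Real.exp c := by
  have hK : 0 ≤ K :=
    nonneg_of_mul_nonneg_left ((norm_nonneg _).trans (hb z hz)) (Real.exp_pos _)
  have him : ∀ w : ℂ, (I + I * w).im = 1 + w.re := fun w => by simp
  have hmain := right_half_plane_norm_le_of_eventually_le_exp (f := fun w => u (I + I * w))
    (C := K * Real.exp c) (z := -I * z - 1) (DifferentiableOn.diffContOnCl fun w hw => ?_)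
    ⟨1, one_lt_two, c, Asymptotics.IsBigO.of_bound (K * Real.exp c) ?_⟩ (fun ε hε => ?_)
    (fun x => ?_) (by simpa using hz)
  · convert! hmain using 3
    linear_combination z * I_sq
  · rw [closure_setOfPred_lt_re] at hw
    have hw' : 0 ≤ w.re := hw
    have hmem : 0 < (I + I * w).im := by rw [him]; linarith
    exact ((hud.differentiableAt (isOpen_upperHalf.mem_nhds hmem)).comp (f := fun w => I + I * w) w
      (by fun_prop)).differentiableWithinAt
  · refine (eventually_principal.2 fun (w : ℂ) (hw : 0 < w.re) => ?_).filter_mono inf_le_right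
    refine (hb _ (by rw [him]; linarith)).trans ?_
    rw [him, mul_add, mul_one, Real.exp_add, ← mul_assoc, Real.rpow_one,
      Real.norm_of_nonneg (Real.exp_pos _).le]
    gcongr
    exact re_le_norm w
  · have hshift := (tendsto_atTop_add_const_left atTop (1 : ℝ) tendsto_id).eventually
      (hax (ε / 2) (half_pos hε))
    filter_upwards [hshift, eventually_ge_atTop 1] with x hx hx1
    rw [show I + I * (x : ℂ) = I * ((1 + id x : ℝ) : ℂ) by push_cast; simp only [id]; ring]
    exact hx.trans (Real.exp_le_exp.2 (by simp only [id]; nlinarith))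
  · simpa using hb (I + I * (x * I)) (by rw [him]; simp)

section
variable {u : ℂ → ℂ} {A : ℝ} (hu : Continuous u) (hud : DifferentiableOn ℂ u upperHalf)
  (hL : MemLp (fun t : ℝ => u t) 2) (hA : 0 ≤ A)
  (hgr : ∀ z ∈ upperHalf, ‖u z‖ ≤ Real.exp (A * ((1 + ‖z‖ ^ 2) / z.im)))
include hu hud hL hA hgr

/-- The factor `exp (16 i A z)` compensates the exponential growth of the moving averages, so that
Cauchy's formula holds for the product. -/
theorem norm_le_exp_of_one_le_im {z : ℂ} (hz : 1 ≤ z.im) :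
    ‖u z‖ ≤ ((∫ x : ℝ, ‖u x‖ ^ 2) + Real.pi) * Real.exp (16 * A * z.im) := by
  have hz0 : 0 < z.im := by linarith
  set g : ℂ → ℂ := fun z => exp ((16 * A : ℝ) * I * z) * u z with hg
  have hgn : ∀ z, ‖g z‖ = Real.exp (-(16 * A * z.im)) * ‖u z‖ := fun z => by
    rw [hg, norm_mul, norm_exp_mul_I_mul]
  have hgreal : ∀ t : ℝ, ‖g t‖ = ‖u t‖ := fun t => by simp [hgn]
  have hgc : Continuous g := by fun_prop
  have hgd : DifferentiableOn ℂ g upperHalf := DifferentiableOn.mul (by fun_prop) hud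
  have hgL : MemLp (fun t : ℝ => g t) 2 :=
    hL.of_le (Continuous.aestronglyMeasurable (by fun_prop))
      (Eventually.of_forall fun t => (hgreal t).le)
  have hcauchy := cauchyInt_eq_of_bounded_movingAverage hgc hgd hgL (fun h hh =>
    ⟨(∫ x : ℝ, ‖g x‖ ^ 2) + 1, fun w hw => by
      simpa using norm_movingAverage_le_exp (c := 16 * A) hgc hgd hgL hA (fun w hw => by
        rw [hgn, sub_eq_neg_add, Real.exp_add]
        exact mul_le_mul_of_nonneg_left (hgr w hw) (Real.exp_pos _).le) hh hw⟩) hz0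
  have hle := norm_cauchyInt_le hgL hz0.ne'
  simp_rw [hcauchy, hgreal] at hle
  have hgle : ‖g z‖ ≤ ‖2 * Real.pi * I * g z‖ := by
    rw [norm_mul _ (g z), show ‖(2 * Real.pi * I : ℂ)‖ = 2 * Real.pi by
      simp [abs_of_pos Real.pi_pos]]
    nlinarith [Real.pi_gt_three, norm_nonneg (g z)]
  have hpi : Real.pi / |z.im| ≤ Real.pi :=
    div_le_self Real.pi_pos.le (hz.trans (le_abs_self _))
  rw [← div_le_iff₀ (Real.exp_pos _), div_eq_mul_inv, ← Real.exp_neg, mul_comm, ← hgn]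
  linarith

variable (hax : ∀ ε > 0, ∀ᶠ y : ℝ in atTop, ‖u (I * y)‖ ≤ Real.exp (ε * y))
include hax

theorem exists_norm_movingAverage_le {h : ℝ} (hh : h ∈ Icc (0 : ℝ) 1) :
    ∃ M : ℝ, ∀ z : ℂ, 0 ≤ z.im → ‖movingAverage h u z‖ ≤ M := by
  set B := ∫ x : ℝ, ‖u x‖ ^ 2
  have : 0 ≤ B := integral_nonneg fun x => by positivity
  refine ⟨(B + Real.pi) * Real.exp (16 * A), fun z hz => ?_⟩
  rcases le_total z.im 1 with hz1 | hz1
  · have hle := norm_movingAverage_le_exp (c := 0) hu hud hL hA (by simpa using hgr) hh hz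
    refine hle.trans ?_
    rw [sub_zero]
    exact mul_le_mul (by linarith [Real.pi_gt_three])
      (Real.exp_le_exp.2 (mul_le_of_le_one_right (by positivity) hz1)) (Real.exp_pos _).le
      (by positivity)
  · have hle : ∀ w : ℂ, 1 ≤ w.im → ‖u w‖ ≤ (B + Real.pi) * Real.exp (16 * A) := fun w =>
      norm_le_of_exponential_type (by positivity) hud
        (fun _ => norm_le_exp_of_one_le_im hu hud hL hA hgr) hax
    refine (norm_movingAverage_le hh.1 fun s _ => hle _ (by simpa using hz1)).trans ?_
    exact mul_le_of_le_one_right (by positivity) hh.2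

theorem cauchyInt_eq_of_growth {z : ℂ} (hz : 0 < z.im) :
    cauchyInt (fun t => u t) z = 2 * Real.pi * I * u z :=
  cauchyInt_eq_of_bounded_movingAverage hu hud hL
    (fun _ => exists_norm_movingAverage_le hu hud hL hA hgr hax) hz

theorem cauchyInt_eq_zero_of_growth {z : ℂ} (hz : z.im < 0) :
    cauchyInt (fun t => u t) z = 0 :=
  cauchyInt_eq_zero_of_bounded_movingAverage hu hud hL
    (fun _ => exists_norm_movingAverage_le hu hud hL hA hgr hax) hz

end

/-! ### Functions of bounded type and nonpositive mean type -/

theorem log_enorm_div_le_iff {w : ℂ} {ε y : ℝ} (hy : 0 < y) :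
    ENNReal.log ‖w‖ₑ / (y : EReal) ≤ (ε : EReal) ↔ ‖w‖ ≤ Real.exp (ε * y) := by
  have hy' : (0 : EReal) < (y : EReal) := by exact_mod_cast hy
  rw [EReal.div_le_iff_le_mul hy' (EReal.coe_ne_top y), ← EReal.coe_mul, ← Real.log_exp (y * ε),
    ← ENNReal.log_ofReal_of_pos (Real.exp_pos _), ENNReal.log_le_log_iff, ← ofReal_norm,
    ENNReal.ofReal_le_ofReal_iff (Real.exp_pos _).le, mul_comm y ε]

theorem meanType_nonpos_iff {f : ℂ → ℂ} :
    meanType f ≤ 0 ↔ ∀ ε > 0, ∀ᶠ y : ℝ in atTop, ‖f (I * y)‖ ≤ Real.exp (ε * y) := by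
  constructor
  · intro h ε hε
    have hlt : meanType f < (ε : EReal) := lt_of_le_of_lt h (by exact_mod_cast hε)
    filter_upwards [eventually_lt_of_limsup_lt hlt, eventually_gt_atTop 0] with y hy hy0
    exact (log_enorm_div_le_iff hy0).1 hy.le
  · refine fun h => EReal.le_of_forall_lt_iff_le.1 fun ε hε => limsup_le_of_le (h := ?_)
    filter_upwards [h ε (by exact_mod_cast hε), eventually_gt_atTop 0] with y hy hy0
    exact (log_enorm_div_le_iff hy0).2 hy

theorem eventually_le_exp_mul (C : ℝ) {ε : ℝ} (hε : 0 < ε) :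
    ∀ᶠ y : ℝ in atTop, C ≤ Real.exp (ε * y) :=
  (Real.tendsto_exp_atTop.comp (tendsto_id.const_mul_atTop hε)).eventually_ge_atTop C

theorem exp_half_mul_exp_half (ε y : ℝ) :
    Real.exp (ε / 2 * y) * Real.exp (ε / 2 * y) = Real.exp (ε * y) := by
  rw [← Real.exp_add]
  ring_nf

theorem I_mul_mem_upperHalf {y : ℝ} (hy : 0 < y) : I * (y : ℂ) ∈ upperHalf := by
  change 0 < (I * (y : ℂ)).im
  simpa using hy

theorem I_mem_upperHalf : I ∈ upperHalf := by simpa using I_mul_mem_upperHalf one_pos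

/-- Functions of bounded type and nonpositive mean type in the upper half-plane. Bounded type alone
does not exclude a factor `exp (-i a z)` with `a > 0`; this condition does. -/
def IsNonposType (f : ℂ → ℂ) : Prop :=
  IsBoundedType f ∧ meanType f ≤ 0

theorem IsBoundedType.congr {f g : ℂ → ℂ} (hf : IsBoundedType f) (h : EqOn f g upperHalf) :
    IsBoundedType g := by
  obtain ⟨hd, P, Q, hP, hQ, hPb, hQb, hQ0, hPQ⟩ := hf
  exact ⟨hd.congr fun z hz => (h hz).symm, P, Q, hP, hQ, hPb, hQb, hQ0,
    fun z hz => h hz ▸ hPQ z hz⟩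

theorem IsNonposType.congr {f g : ℂ → ℂ} (hf : IsNonposType f) (h : EqOn f g upperHalf) :
    IsNonposType g := by
  refine ⟨hf.1.congr h, meanType_nonpos_iff.2 fun ε hε => ?_⟩
  filter_upwards [meanType_nonpos_iff.1 hf.2 ε hε, eventually_gt_atTop 0] with y hy hy0
  rwa [← h (I_mul_mem_upperHalf hy0)]

theorem exists_mul_ne_zero {Q₁ Q₂ : ℂ → ℂ} (h₁ : DifferentiableOn ℂ Q₁ upperHalf)
    (h₂ : DifferentiableOn ℂ Q₂ upperHalf) (hQ₁ : ∃ z ∈ upperHalf, Q₁ z ≠ 0)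
    (hQ₂ : ∃ z ∈ upperHalf, Q₂ z ≠ 0) : ∃ z ∈ upperHalf, Q₁ z * Q₂ z ≠ 0 := by
  by_contra! h
  rcases (h₁.analyticOnNhd isOpen_upperHalf).eq_zero_or_eq_zero_of_mul_eq_zero
    (h₂.analyticOnNhd isOpen_upperHalf) h convex_upperHalf.isPreconnected with h0 | h0
  · obtain ⟨z, hz, hne⟩ := hQ₁
    exact hne (h0 z hz)
  · obtain ⟨z, hz, hne⟩ := hQ₂
    exact hne (h0 z hz)

theorem exists_norm_mul_le {P Q : ℂ → ℂ} (hP : ∃ C : ℝ, ∀ z ∈ upperHalf, ‖P z‖ ≤ C)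
    (hQ : ∃ C : ℝ, ∀ z ∈ upperHalf, ‖Q z‖ ≤ C) :
    ∃ C : ℝ, ∀ z ∈ upperHalf, ‖P z * Q z‖ ≤ C := by
  obtain ⟨C, hC⟩ := hP
  obtain ⟨D, hD⟩ := hQ
  refine ⟨C * D, fun z hz => ?_⟩
  rw [norm_mul]
  exact mul_le_mul (hC z hz) (hD z hz) (norm_nonneg _) ((norm_nonneg _).trans (hC z hz))

theorem IsBoundedType.add {f g : ℂ → ℂ} (hf : IsBoundedType f) (hg : IsBoundedType g) :
    IsBoundedType fun z => f z + g z := by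
  obtain ⟨hd₁, P₁, Q₁, hP₁, hQ₁, hP₁b, hQ₁b, h0₁, hPQ₁⟩ := hf
  obtain ⟨hd₂, P₂, Q₂, hP₂, hQ₂, hP₂b, hQ₂b, h0₂, hPQ₂⟩ := hg
  obtain ⟨C₁, hC₁⟩ := exists_norm_mul_le hP₁b hQ₂b
  obtain ⟨C₂, hC₂⟩ := exists_norm_mul_le hP₂b hQ₁b
  refine ⟨hd₁.add hd₂, fun z => P₁ z * Q₂ z + P₂ z * Q₁ z, fun z => Q₁ z * Q₂ z,
    (hP₁.mul hQ₂).add (hP₂.mul hQ₁), hQ₁.mul hQ₂,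
    ⟨C₁ + C₂, fun z hz => (norm_add_le _ _).trans (add_le_add (hC₁ z hz) (hC₂ z hz))⟩,
    exists_norm_mul_le hQ₁b hQ₂b, exists_mul_ne_zero hQ₁ hQ₂ h0₁ h0₂, fun z hz => ?_⟩
  simp only [← hPQ₁ z hz, ← hPQ₂ z hz]
  ring

theorem IsBoundedType.mul_bounded {f θ : ℂ → ℂ} (hf : IsBoundedType f)
    (hθ : DifferentiableOn ℂ θ upperHalf) (hb : ∃ C : ℝ, ∀ z ∈ upperHalf, ‖θ z‖ ≤ C) :
    IsBoundedType fun z => f z * θ z := by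
  obtain ⟨hd, P, Q, hP, hQ, hPb, hQb, h0, hPQ⟩ := hf
  refine ⟨hd.mul hθ, fun z => P z * θ z, Q, hP.mul hθ, hQ, exists_norm_mul_le hPb hb, hQb, h0,
    fun z hz => ?_⟩
  simp only [← hPQ z hz]
  ring

theorem IsNonposType.add {f g : ℂ → ℂ} (hf : IsNonposType f) (hg : IsNonposType g) :
    IsNonposType fun z => f z + g z := by
  refine ⟨hf.1.add hg.1, meanType_nonpos_iff.2 fun ε hε => ?_⟩
  filter_upwards [meanType_nonpos_iff.1 hf.2 _ (half_pos hε),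
    meanType_nonpos_iff.1 hg.2 _ (half_pos hε), eventually_le_exp_mul 2 (half_pos hε)]
    with y hfy hgy h2
  calc ‖f (I * y) + g (I * y)‖ ≤ ‖f (I * y)‖ + ‖g (I * y)‖ := norm_add_le _ _
    _ ≤ 2 * Real.exp (ε / 2 * y) := by linarith
    _ ≤ Real.exp (ε / 2 * y) * Real.exp (ε / 2 * y) := by gcongr
    _ = Real.exp (ε * y) := exp_half_mul_exp_half ε y

theorem IsNonposType.mul_bounded {f θ : ℂ → ℂ} (hf : IsNonposType f)
    (hθ : DifferentiableOn ℂ θ upperHalf) (hb : ∃ C : ℝ, ∀ z ∈ upperHalf, ‖θ z‖ ≤ C) :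
    IsNonposType fun z => f z * θ z := by
  refine ⟨hf.1.mul_bounded hθ hb, meanType_nonpos_iff.2 fun ε hε => ?_⟩
  obtain ⟨C, hC⟩ := hb
  filter_upwards [meanType_nonpos_iff.1 hf.2 _ (half_pos hε),
    eventually_le_exp_mul C (half_pos hε), eventually_gt_atTop 0] with y hfy hCy hy
  rw [norm_mul, ← exp_half_mul_exp_half]
  gcongr
  exact (hC _ (I_mul_mem_upperHalf hy)).trans hCy

theorem isNonposType_one : IsNonposType fun _ => 1 := by
  refine ⟨⟨differentiableOn_const 1, fun _ => 1, fun _ => 1, differentiableOn_const 1,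
    differentiableOn_const 1, ⟨1, by simp⟩, ⟨1, by simp⟩, ⟨I, I_mem_upperHalf, one_ne_zero⟩,
    by simp⟩, meanType_nonpos_iff.2 fun ε hε => ?_⟩
  simpa using eventually_le_exp_mul 1 hε

theorem isNonposType_of_bounded {f : ℂ → ℂ} (hf : DifferentiableOn ℂ f upperHalf)
    (hb : ∃ C : ℝ, ∀ z ∈ upperHalf, ‖f z‖ ≤ C) : IsNonposType f := by
  simpa using isNonposType_one.mul_bounded hf hb

theorem IsNonposType.const_mul {f : ℂ → ℂ} (hf : IsNonposType f) (c : ℂ) :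
    IsNonposType fun z => c * f z := by
  simpa [mul_comm] using
    hf.mul_bounded (θ := fun _ => c) (differentiableOn_const c) ⟨‖c‖, fun _ _ => le_rfl⟩

theorem isNonposType_zero : IsNonposType fun _ => 0 := by
  simpa using isNonposType_one.const_mul 0

/-! ### Elementary properties of de Branges spaces -/

theorem mem_space_iff {E f : ℂ → ℂ} : f ∈ space E ↔ Differentiable ℂ f ∧
    MemLp (fun t : ℝ => f t / E t) 2 ∧
    IsNonposType (fun z => f z / E z) ∧ IsNonposType (fun z => starFn f z / E z) := by
  simp only [space, IsNonposType, mem_ofPred_eq, and_assoc]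

theorem starFn_starFn (f : ℂ → ℂ) : starFn (starFn f) = f := by
  ext z
  simp [starFn]

theorem starFn_ofReal (f : ℂ → ℂ) (t : ℝ) : starFn f t = conj (f t) := by
  simp [starFn]

theorem differentiable_starFn {f : ℂ → ℂ} (hf : Differentiable ℂ f) :
    Differentiable ℂ (starFn f) := by
  intro z
  have h : DifferentiableAt ℂ f (conj z) := hf _
  simpa [starFn, Function.comp_def] using! h.conj_conj

theorem aestronglyMeasurable_div {E f : ℂ → ℂ} (hE : Differentiable ℂ E)
    (hf : Differentiable ℂ f) : AEStronglyMeasurable (fun t : ℝ => f t / E t) volume :=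
  ((hf.continuous.comp continuous_ofReal).measurable.div
    (hE.continuous.comp continuous_ofReal).measurable).aestronglyMeasurable

theorem norm_starFn_div_ofReal (E f : ℂ → ℂ) (t : ℝ) : ‖starFn f t / E t‖ = ‖f t / E t‖ := by
  rw [starFn_ofReal, norm_div, norm_div, RCLike.norm_conj]

theorem starFn_mem_space {E f : ℂ → ℂ} (hE : Differentiable ℂ E) (hf : f ∈ space E) :
    starFn f ∈ space E := by
  obtain ⟨hd, hL, hs, hs'⟩ := mem_space_iff.1 hf
  refine mem_space_iff.2 ⟨differentiable_starFn hd, ?_, hs', by rwa [starFn_starFn]⟩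
  exact hL.of_le (aestronglyMeasurable_div hE (differentiable_starFn hd))
    (Eventually.of_forall fun t => (norm_starFn_div_ofReal E f t).le)

theorem add_mem_space {E f g : ℂ → ℂ} (hf : f ∈ space E) (hg : g ∈ space E) :
    f + g ∈ space E := by
  rw [mem_space_iff] at hf hg ⊢
  refine ⟨hf.1.add hg.1, (memLp_congr_ae (Eventually.of_forall fun t => ?_)).1
    (hf.2.1.add hg.2.1), (hf.2.2.1.add hg.2.2.1).congr fun z _ => ?_,
    (hf.2.2.2.add hg.2.2.2).congr fun z _ => ?_⟩
  · simp [add_div]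
  · simp [add_div]
  · simp [add_div, starFn]

theorem smul_mem_space {E f : ℂ → ℂ} (c : ℂ) (hf : f ∈ space E) : c • f ∈ space E := by
  rw [mem_space_iff] at hf ⊢
  refine ⟨hf.1.const_smul c, ?_, (hf.2.2.1.const_mul c).congr fun z _ => ?_,
    (hf.2.2.2.const_mul (conj c)).congr fun z _ => ?_⟩
  · simpa [mul_div_assoc] using hf.2.1.const_mul c
  · simp [mul_div_assoc]
  · simp [mul_div_assoc, starFn]

theorem zero_mem_space (E : ℂ → ℂ) : (0 : ℂ → ℂ) ∈ space E := by
  rw [mem_space_iff]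
  refine ⟨differentiable_const 0, by simp, ?_, ?_⟩
  · simpa using isNonposType_zero
  · simpa [starFn] using isNonposType_zero

theorem ip_eq_integral (E f g : ℂ → ℂ) :
    ip E f g = ∫ t : ℝ, f t / E t * conj (g t / E t) := by
  refine integral_congr_ae (Eventually.of_forall fun t => ?_)
  simp only
  rw [map_div₀, div_mul_div_comm, mul_conj, normSq_eq_norm_sq]

section
variable {E : ℂ → ℂ} (hE : IsHermiteBiehler E)
include hE

theorem IsHermiteBiehler.ne_zero {z : ℂ} (hz : 0 < z.im) : E z ≠ 0 :=
  norm_pos_iff.1 ((norm_nonneg _).trans_lt (hE.2 z hz))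

theorem IsHermiteBiehler.mul {F : ℂ → ℂ} (hF : IsHermiteBiehler F) :
    IsHermiteBiehler (E * F) := by
  refine ⟨hE.1.mul hF.1, fun z hz => ?_⟩
  simp only [Pi.mul_apply, norm_mul]
  exact mul_lt_mul'' (hE.2 z hz) (hF.2 z hz) (norm_nonneg _) (norm_nonneg _)

theorem IsHermiteBiehler.differentiableOn_div {f : ℂ → ℂ} (hf : Differentiable ℂ f) :
    DifferentiableOn ℂ (fun z => f z / E z) upperHalf :=
  hf.differentiableOn.div hE.1.differentiableOn fun _ hz => hE.ne_zero hz

theorem IsHermiteBiehler.norm_starFn_div_le {z : ℂ} (hz : z ∈ upperHalf) :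
    ‖starFn E z / E z‖ ≤ 1 := by
  rw [norm_div, starFn, RCLike.norm_conj]
  exact div_le_one_of_le₀ (hE.2 z hz).le (norm_nonneg _)

theorem IsHermiteBiehler.isNonposType_mul_starFn_div {f : ℂ → ℂ} (hf : IsNonposType f) :
    IsNonposType fun z => f z * (starFn E z / E z) :=
  hf.mul_bounded (hE.differentiableOn_div (differentiable_starFn hE.1))
    ⟨1, fun _ => hE.norm_starFn_div_le⟩

end

theorem ae_ne_zero_of_differentiable {f : ℂ → ℂ} (hf : Differentiable ℂ f)
    (h0 : ∃ z, f z ≠ 0) : ∀ᵐ t : ℝ, f t ≠ 0 := by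
  obtain ⟨z₀, hz₀⟩ := h0
  have ha : AnalyticOnNhd ℂ f univ := fun z _ => hf.analyticAt z
  have hr : AnalyticOnNhd ℝ (fun t : ℝ => f t) univ := fun t _ =>
    (ha t (mem_univ _)).restrictScalars.comp (ofRealCLM.analyticAt t)
  have hcod : ∀ᶠ t : ℝ in codiscreteWithin univ, f t ≠ 0 := by
    refine (hr.eqOn_zero_or_eventually_ne_zero_of_preconnected isPreconnected_univ).resolve_left ?_
    intro hreal
    have ht : Tendsto (fun t : ℝ => (t : ℂ)) (𝓝[≠] 0) (𝓝[≠] 0) :=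
      tendsto_nhdsWithin_iff.2 ⟨(continuous_ofReal.tendsto' 0 0 ofReal_zero).mono_left
        nhdsWithin_le_nhds, by
          filter_upwards [self_mem_nhdsWithin] with t ht
          simpa using ht⟩
    have hfr : ∃ᶠ z in 𝓝[≠] (0 : ℂ), f z = 0 :=
      ht.frequently (Eventually.of_forall fun t => hreal (mem_univ t)).frequently
    exact hz₀ (ha.eqOn_zero_of_preconnected_of_frequently_eq_zero isPreconnected_univ
      (mem_univ 0) hfr (mem_univ z₀))
  have := ae_restrict_le_codiscreteWithin (μ := (volume : Measure ℝ)) MeasurableSet.univ hcod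
  rwa [Measure.restrict_univ] at this

theorem IsHermiteBiehler.ae_ne_zero {E : ℂ → ℂ} (hE : IsHermiteBiehler E) :
    ∀ᵐ t : ℝ, E t ≠ 0 :=
  ae_ne_zero_of_differentiable hE.1 ⟨I, hE.ne_zero I_mem_upperHalf⟩

/-! ### Cauchy's formula for the quotients `f / E` -/

theorem isBigO_inv_sub_of_meromorphicOrderAt_neg {q : ℂ → ℂ} {a : ℂ}
    (h : meromorphicOrderAt q a < 0) : (fun z => (z - a)⁻¹) =O[𝓝[≠] a] q := by
  obtain ⟨n, hn⟩ := WithTop.ne_top_iff_exists.1 h.ne_top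
  have hn0 : n < 0 := by exact_mod_cast hn ▸ h
  have hq : MeromorphicAt q a := meromorphicAt_of_meromorphicOrderAt_ne_zero h.ne
  obtain ⟨g, hg, hga, hqg⟩ := (meromorphicOrderAt_eq_int_iff hq).1 hn.symm
  have hcont : ContinuousAt (fun z : ℂ => (z - a) ^ (-n - 1).toNat / g z) a :=
    ContinuousAt.div (by fun_prop) hg.continuousAt hga
  have hbd : (fun z : ℂ => (z - a) ^ (-n - 1).toNat / g z) =O[𝓝[≠] a] fun _ => (1 : ℂ) :=
    (hcont.tendsto.isBigO_one ℂ).mono nhdsWithin_le_nhds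
  refine (hbd.mul (Asymptotics.isBigO_refl q _)).congr' ?_ (.of_forall fun z => one_mul _)
  filter_upwards [hqg, self_mem_nhdsWithin,
    nhdsWithin_le_nhds (hg.continuousAt.eventually_ne hga)] with z hz hza hgz
  have hza' : z - a ≠ 0 := sub_ne_zero.2 hza
  rw [hz, smul_eq_mul, ← zpow_natCast, Int.toNat_of_nonneg (by lia)]
  field_simp
  rw [← zpow_one_add₀ hza', ← zpow_add₀ hza']
  simp

theorem tendsto_ofReal_nhdsNE (x : ℝ) :
    Tendsto (fun t : ℝ => (t : ℂ)) (𝓝[≠] x) (𝓝[≠] (x : ℂ)) :=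
  continuous_ofReal.continuousAt.continuousWithinAt.tendsto_nhdsWithin fun _ ht => by
    simpa using ht

theorem meromorphicOrderAt_nonneg_of_memLp {q : ℂ → ℂ} (hL : MemLp (fun t : ℝ => q t) 2)
    (x : ℝ) : 0 ≤ meromorphicOrderAt q x := by
  by_contra! hneg
  have hO : (fun t : ℝ => (t - x)⁻¹) =O[𝓝[≠] x] fun t : ℝ => q t := by
    refine (Asymptotics.IsBigO.congr_left ((isBigO_inv_sub_of_meromorphicOrderAt_neg
      hneg).comp_tendsto (tendsto_ofReal_nhdsNE x)).norm_left fun t => ?_).of_norm_left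
    change ‖((t : ℂ) - x)⁻¹‖ = ‖(t - x)⁻¹‖
    rw [← ofReal_sub, norm_inv, norm_inv, norm_real]
  refine not_intervalIntegrable_of_sub_inv_isBigO_punctured hO (a := x - 1) (b := x + 1)
    (by linarith) (by rw [uIcc_of_le (by linarith)]; constructor <;> linarith) ?_
  rw [intervalIntegrable_iff_integrableOn_Ioc_of_le (by linarith)]
  exact (hL.restrict _).integrable (by norm_num)

theorem exists_analyticAt_eqOn_of_memLp {E f : ℂ → ℂ} (hE : Differentiable ℂ E)
    (hf : Differentiable ℂ f) (hL : MemLp (fun t : ℝ => f t / E t) 2) :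
    ∃ v : ℂ → ℂ, (∀ t : ℝ, AnalyticAt ℂ v t) ∧ EqOn v (fun z => f z / E z) {z | E z ≠ 0} := by
  set q : ℂ → ℂ := fun z => f z / E z
  have hq : MeromorphicOn q univ := fun z _ =>
    (hf.analyticAt z).meromorphicAt.div (hE.analyticAt z).meromorphicAt
  refine ⟨toMeromorphicNFOn q univ, fun t => ?_, fun z hz => ?_⟩
  · rw [← (meromorphicNFOn_toMeromorphicNFOn q univ
      (mem_univ _)).meromorphicOrderAt_nonneg_iff_analyticAt,
      meromorphicOrderAt_toMeromorphicNFOn hq (mem_univ _)]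
    exact meromorphicOrderAt_nonneg_of_memLp hL t
  · have ha : AnalyticAt ℂ q z := (hf.analyticAt z).div (hE.analyticAt z) hz
    rw [toMeromorphicNFOn_eq_toMeromorphicNFAt hq (mem_univ z),
      toMeromorphicNFAt_eq_self.2 ha.meromorphicNFAt]

theorem cauchyInt_congr {φ ψ : ℝ → ℂ} (h : φ =ᵐ[volume] ψ) (z : ℂ) :
    cauchyInt φ z = cauchyInt ψ z :=
  integral_congr_ae (h.mono fun t ht => by simp only [ht])

section
variable {E f : ℂ → ℂ} (hE : IsHermiteBiehler E)
include hE

theorem IsHermiteBiehler.exists_continuous_eqOn_div (hf : Differentiable ℂ f)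
    (hL : MemLp (fun t : ℝ => f t / E t) 2) :
    ∃ u : ℂ → ℂ, Continuous u ∧ EqOn u (fun z => f z / E z) upperHalf ∧
      (fun t : ℝ => u t) =ᵐ[volume] fun t : ℝ => f t / E t := by
  obtain ⟨v, hv, hvq⟩ := exists_analyticAt_eqOn_of_memLp hE.1 hf hL
  have hvc : ContinuousOn v {z | 0 ≤ z.im} := by
    intro z (hz : 0 ≤ z.im)
    rcases hz.eq_or_lt with h0 | hpos
    · have hzr : z = (z.re : ℂ) := Complex.ext rfl (by simpa using h0.symm)
      exact hzr ▸ (hv z.re).continuousAt.continuousWithinAt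
    · have hd := (hE.differentiableOn_div hf).continuousOn.congr
        fun w (hw : w ∈ upperHalf) => hvq (hE.ne_zero hw)
      exact (hd.continuousAt (isOpen_upperHalf.mem_nhds hpos)).continuousWithinAt
  have huv : ∀ z : ℂ, 0 ≤ z.im → v (z.re + (max z.im 0 : ℝ) * I) = v z := fun z hz => by
    rw [max_eq_left hz, re_add_im]
  refine ⟨fun z => v (z.re + (max z.im 0 : ℝ) * I),
    hvc.comp_continuous (by fun_prop) fun z => by simp, fun z (hz : 0 < z.im) => ?_, ?_⟩
  · simp only [huv z hz.le, hvq (hE.ne_zero hz)]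
  · filter_upwards [hE.ae_ne_zero] with t ht
    rw [huv t (by simp), hvq ht]

theorem IsHermiteBiehler.exists_continuous_growth (hf : f ∈ space E) :
    ∃ u : ℂ → ℂ, Continuous u ∧ EqOn u (fun z => f z / E z) upperHalf ∧
      (fun t : ℝ => u t) =ᵐ[volume] (fun t : ℝ => f t / E t) ∧
      (∃ A : ℝ, 0 ≤ A ∧ ∀ z ∈ upperHalf, ‖u z‖ ≤ Real.exp (A * ((1 + ‖z‖ ^ 2) / z.im))) ∧
      ∀ ε > 0, ∀ᶠ y : ℝ in atTop, ‖u (I * y)‖ ≤ Real.exp (ε * y) := by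
  obtain ⟨hfd, hL, hs, -⟩ := mem_space_iff.1 hf
  obtain ⟨u, huc, huE, hae⟩ := hE.exists_continuous_eqOn_div hfd hL
  have hu : IsNonposType u := hs.congr huE.symm
  exact ⟨u, huc, huE, hae, hu.1.exists_growth, meanType_nonpos_iff.1 hu.2⟩

theorem IsHermiteBiehler.cauchyInt_div_eq (hf : f ∈ space E) {z : ℂ} (hz : 0 < z.im) :
    cauchyInt (fun t => f t / E t) z = 2 * Real.pi * I * (f z / E z) := by
  obtain ⟨u, huc, huE, hae, ⟨A, hA, hgr⟩, hax⟩ := hE.exists_continuous_growth hf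
  rw [← cauchyInt_congr hae, cauchyInt_eq_of_growth huc
    ((hE.differentiableOn_div hf.1).congr huE) ((memLp_congr_ae hae).2 hf.2.1) hA hgr hax hz,
    huE hz]

theorem IsHermiteBiehler.cauchyInt_div_eq_zero (hf : f ∈ space E) {z : ℂ} (hz : z.im < 0) :
    cauchyInt (fun t => f t / E t) z = 0 := by
  obtain ⟨u, huc, huE, hae, ⟨A, hA, hgr⟩, hax⟩ := hE.exists_continuous_growth hf
  rw [← cauchyInt_congr hae, cauchyInt_eq_zero_of_growth huc
    ((hE.differentiableOn_div hf.1).congr huE) ((memLp_congr_ae hae).2 hf.2.1) hA hgr hax hz]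

end

theorem div_sub_div_conj {z : ℂ} (hz : z.im ≠ 0) (a : ℂ) (t : ℝ) :
    a / ((t : ℂ) - z) - a / ((t : ℂ) - conj z) =
      2 * z.im * I * (a * (((normSq ((t : ℂ) - z))⁻¹ : ℝ) : ℂ)) := by
  have h1 := ofReal_sub_ne_zero hz t
  have h2 : (t : ℂ) - conj z ≠ 0 := ofReal_sub_ne_zero (by simpa using hz) t
  have h3 : 2 * (z.im : ℂ) * I = z - conj z := by rw [sub_conj]; push_cast; ring
  rw [ofReal_inv, normSq_eq_conj_mul_self, map_sub, conj_ofReal, h3]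
  field_simp
  ring

section
variable {v : ℝ → ℂ} (hv : MemLp v 2)
include hv

theorem memLp_ofReal_norm : MemLp (fun t => (‖v t‖ : ℂ)) 2 :=
  hv.of_le (continuous_ofReal.comp_aestronglyMeasurable hv.1.norm) (.of_forall fun t => by simp)

theorem integrable_norm_mul_inv_normSq {z : ℂ} (hz : z.im ≠ 0) :
    Integrable fun t : ℝ => ‖v t‖ * (normSq ((t : ℂ) - z))⁻¹ := by
  refine ((integrable_div_ofReal_sub (memLp_ofReal_norm hv) hz).im.div_const z.im).congr
    (.of_forall fun t => ?_)
  simp only [RCLike.im_to_complex, div_eq_mul_inv, im_ofReal_mul, inv_im]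
  simp
  field_simp

theorem im_cauchyInt_norm {z : ℂ} (hz : z.im ≠ 0) :
    (cauchyInt (fun t => (‖v t‖ : ℂ)) z).im =
      z.im * ∫ t : ℝ, ‖v t‖ * (normSq ((t : ℂ) - z))⁻¹ := by
  have h := imCLM.integral_comp_comm (integrable_div_ofReal_sub (memLp_ofReal_norm hv) hz)
  simp only [imCLM_apply] at h
  rw [cauchyInt, ← h, ← integral_const_mul]
  refine integral_congr_ae (.of_forall fun t => ?_)
  simp only [div_eq_mul_inv, im_ofReal_mul, inv_im]
  simp
  ring

theorem cauchyInt_sub_cauchyInt_conj {z : ℂ} (hz : z.im ≠ 0) :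
    cauchyInt v z - cauchyInt v (conj z) =
      2 * z.im * I * ∫ t : ℝ, v t * (((normSq ((t : ℂ) - z))⁻¹ : ℝ) : ℂ) := by
  rw [cauchyInt, cauchyInt, ← integral_sub (integrable_div_ofReal_sub hv hz)
    (integrable_div_ofReal_sub hv (by simpa using hz)), ← integral_const_mul]
  simp_rw [div_sub_div_conj hz]

theorem norm_cauchyInt_sub_cauchyInt_conj_le {z : ℂ} (hz : 0 < z.im) :
    ‖cauchyInt v z - cauchyInt v (conj z)‖ ≤ 2 * (cauchyInt (fun t => (‖v t‖ : ℂ)) z).im := by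
  rw [cauchyInt_sub_cauchyInt_conj hv hz.ne', im_cauchyInt_norm hv hz.ne']
  have h := norm_integral_le_of_norm_le (integrable_norm_mul_inv_normSq hv hz.ne')
    (f := fun t => v t * (((normSq ((t : ℂ) - z))⁻¹ : ℝ) : ℂ)) (.of_forall fun t => by
      rw [norm_mul, norm_real, Real.norm_of_nonneg (inv_nonneg.2 (normSq_nonneg _))])
  have h2 : ‖(2 * z.im * I : ℂ)‖ = 2 * z.im := by simp [abs_of_pos hz]
  rw [norm_mul, h2, ← mul_assoc]
  gcongr

end

theorem isBoundedType_of_norm_le_re {G N : ℂ → ℂ} (hG : DifferentiableOn ℂ G upperHalf)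
    (hN : DifferentiableOn ℂ N upperHalf) (hGN : ∀ z ∈ upperHalf, ‖G z‖ ≤ (N z).re) :
    IsBoundedType G := by
  have hle : ∀ z ∈ upperHalf, 1 + ‖G z‖ ≤ ‖1 + N z‖ := fun z hz => by
    have := re_le_norm (1 + N z)
    rw [add_re, one_re] at this
    linarith [hGN z hz]
  have hne : ∀ z ∈ upperHalf, 1 + N z ≠ 0 := fun z hz =>
    norm_pos_iff.1 (by linarith [hle z hz, norm_nonneg (G z)])
  refine ⟨hG, fun z => G z / (1 + N z), fun z => 1 / (1 + N z), hG.div (by fun_prop) hne,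
    DifferentiableOn.div (by fun_prop) (by fun_prop) hne, ⟨1, fun z hz => ?_⟩, ⟨1, fun z hz => ?_⟩,
    ⟨I, I_mem_upperHalf, one_div_ne_zero (hne I I_mem_upperHalf)⟩, fun z _ => mul_one_div _ _⟩
  · rw [norm_div]
    exact div_le_one_of_le₀ (by linarith [hle z hz]) (norm_nonneg _)
  · rw [norm_div, norm_one]
    exact div_le_one_of_le₀ (by linarith [hle z hz, norm_nonneg (G z)]) (norm_nonneg _)

theorem isNonposType_of_cauchyInt {v : ℝ → ℂ} {G : ℂ → ℂ} (hv : MemLp v 2)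
    (hG : ∀ z : ℂ, 0 < z.im → cauchyInt v z = 2 * Real.pi * I * G z)
    (h0 : ∀ z : ℂ, z.im < 0 → cauchyInt v z = 0) : IsNonposType G := by
  have hp : ‖(2 * Real.pi * I : ℂ)‖ = 2 * Real.pi := by simp [abs_of_pos Real.pi_pos]
  have hGle : ∀ z : ℂ, 0 < z.im → ‖G z‖ ≤ ‖cauchyInt v z‖ := fun z hz => by
    rw [hG z hz, norm_mul, hp]
    exact le_mul_of_one_le_left (norm_nonneg _) (by linarith [Real.pi_gt_three])
  have hGd : DifferentiableOn ℂ G upperHalf := by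
    refine DifferentiableOn.congr (f := fun z => (2 * Real.pi * I)⁻¹ * cauchyInt v z)
      (fun z (hz : 0 < z.im) =>
        ((differentiableAt_cauchyInt hv hz.ne').const_mul _).differentiableWithinAt)
      fun z hz => ?_
    rw [hG z hz, inv_mul_cancel_left₀ two_pi_I_ne_zero]
  refine ⟨isBoundedType_of_norm_le_re hGd
    (N := fun z => -2 * I * cauchyInt (fun t => (‖v t‖ : ℂ)) z) (fun z (hz : 0 < z.im) =>
      ((differentiableAt_cauchyInt (memLp_ofReal_norm hv)
        hz.ne').const_mul _).differentiableWithinAt) fun z (hz : 0 < z.im) => ?_,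
    meanType_nonpos_iff.2 fun ε hε => ?_⟩
  · have h := norm_cauchyInt_sub_cauchyInt_conj_le hv hz
    rw [h0 (conj z) (by simpa using hz), sub_zero] at h
    exact (hGle z hz).trans (h.trans_eq (by simp))
  · filter_upwards [eventually_le_exp_mul ((∫ t : ℝ, ‖v t‖ ^ 2) + Real.pi) hε,
      eventually_ge_atTop 1] with y hy hy1
    have hy0 : 0 < y := by linarith
    have h := norm_cauchyInt_le hv (I_mul_mem_upperHalf hy0).ne'
    have him : (I * (y : ℂ)).im = y := by simp
    rw [him, abs_of_pos hy0] at h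
    calc ‖G (I * y)‖ ≤ (∫ t : ℝ, ‖v t‖ ^ 2) + Real.pi / y :=
          (hGle _ (I_mul_mem_upperHalf hy0)).trans h
      _ ≤ (∫ t : ℝ, ‖v t‖ ^ 2) + Real.pi := by gcongr; exact div_le_self Real.pi_pos.le hy1
      _ ≤ Real.exp (ε * y) := hy

/-! ### Limits in de Branges spaces -/

/-- The de Branges space `H(E)` as a submodule of the functions on `ℂ`. -/
def spaceSubmodule (E : ℂ → ℂ) : Submodule ℂ (ℂ → ℂ) where
  carrier := space E
  add_mem' := add_mem_space
  zero_mem' := zero_mem_space E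
  smul_mem' c _ hf := smul_mem_space c hf

theorem memLp_div {E : ℂ → ℂ} (f : spaceSubmodule E) :
    MemLp (fun t : ℝ => (f : ℂ → ℂ) t / E t) 2 :=
  (mem_space_iff.1 f.2).2.1

/-- The embedding `f ↦ f / E` of the de Branges space `H(E)` in `L²(ℝ)`. -/
def toL2 (E : ℂ → ℂ) : spaceSubmodule E →ₗ[ℂ] Lp ℂ 2 (volume : Measure ℝ) where
  toFun f := (memLp_div f).toLp
  map_add' f g := by
    rw [← MemLp.toLp_add, MemLp.toLp_eq_toLp_iff]
    exact .of_forall fun t => by simp [add_div]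
  map_smul' c f := by
    rw [RingHom.id_apply, ← MemLp.toLp_const_smul, MemLp.toLp_eq_toLp_iff]
    exact .of_forall fun t => by simp [mul_div_assoc]

theorem coeFn_toL2 {E : ℂ → ℂ} (f : spaceSubmodule E) :
    toL2 E f =ᵐ[volume] fun t : ℝ => (f : ℂ → ℂ) t / E t :=
  MemLp.coeFn_toLp (memLp_div f)

theorem inner_toL2 {E : ℂ → ℂ} (f g : spaceSubmodule E) :
    inner ℂ (toL2 E g) (toL2 E f) = ip E f g := by
  rw [L2.inner_def, ip_eq_integral]
  refine integral_congr_ae ?_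
  filter_upwards [coeFn_toL2 f, coeFn_toL2 g] with t h1 h2
  rw [h1, h2, RCLike.inner_apply]

theorem norm_toL2_eq_of_ae {E F : ℂ → ℂ} {f : spaceSubmodule E} {g : spaceSubmodule F}
    (h : ∀ᵐ t : ℝ, ‖(f : ℂ → ℂ) t / E t‖ = ‖(g : ℂ → ℂ) t / F t‖) : ‖toL2 E f‖ = ‖toL2 F g‖ := by
  refine congrArg ENNReal.toReal (eLpNorm_congr_norm_ae ?_)
  filter_upwards [h, coeFn_toL2 f, coeFn_toL2 g] with t h1 h2 h3
  rw [h2, h3, h1]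

theorem exists_tendsto_of_dist_eq {ι X Y : Type*} [PseudoMetricSpace X] [PseudoMetricSpace Y]
    [CompleteSpace Y] {l : Filter ι} [l.NeBot] {u : ι → X} {v : ι → Y} {x : X}
    (h : ∀ i j, dist (v i) (v j) = dist (u i) (u j)) (hx : Tendsto u l (𝓝 x)) :
    ∃ y, Tendsto v l (𝓝 y) := by
  refine CompleteSpace.complete (Metric.cauchy_iff.2 ⟨inferInstance, fun ε hε => ?_⟩)
  obtain ⟨s, hs, hsε⟩ := (Metric.cauchy_iff.1 hx.cauchy_map).2 ε hε
  refine ⟨v '' (u ⁻¹' s), image_mem_map hs, ?_⟩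
  rintro _ ⟨i, hi, rfl⟩ _ ⟨j, hj, rfl⟩
  exact (h i j).trans_lt (hsε _ hi _ hj)

theorem tendsto_cauchyInt {u : ℕ → Lp ℂ 2 (volume : Measure ℝ)} {v : Lp ℂ 2 (volume : Measure ℝ)}
    (h : Tendsto u atTop (𝓝 v)) {z : ℂ} (hz : z.im ≠ 0) :
    Tendsto (fun n => cauchyInt (u n) z) atTop (𝓝 (cauchyInt v z)) := by
  have hm : MemLp (fun t : ℝ => conj (((t : ℂ) - z)⁻¹)) 2 := (memLp_inv_ofReal_sub hz).star
  have key : ∀ u : Lp ℂ 2 (volume : Measure ℝ), cauchyInt u z = inner ℂ hm.toLp u := by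
    intro u
    rw [L2.inner_def, cauchyInt]
    refine integral_congr_ae ?_
    filter_upwards [hm.coeFn_toLp] with t ht
    rw [ht, RCLike.inner_apply, conj_conj, div_eq_mul_inv]
  simp_rw [key]
  exact tendsto_const_nhds.inner h

section
variable {E g : ℂ → ℂ} {f : ℕ → spaceSubmodule E} {v : Lp ℂ 2 (volume : Measure ℝ)}
  (hv : Tendsto (fun n => toL2 E (f n)) atTop (𝓝 v))
include hv

theorem ae_eq_div_of_tendsto (hfg : ∀ z, Tendsto (fun n => (f n : ℂ → ℂ) z) atTop (𝓝 (g z))) :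
    v =ᵐ[volume] fun t : ℝ => g t / E t := by
  obtain ⟨ns, hns, hlim⟩ := (tendstoInMeasure_of_tendsto_Lp hv).exists_seq_tendsto_ae
  have hall : ∀ᵐ t : ℝ, ∀ n, toL2 E (f n) t = (f n : ℂ → ℂ) t / E t :=
    ae_all_iff.2 fun n => coeFn_toL2 (f n)
  filter_upwards [hlim, hall] with t h1 h2
  refine tendsto_nhds_unique h1 ?_
  simp_rw [h2]
  exact ((hfg t).comp hns.tendsto_atTop).div_const _

theorem toL2_eq_of_tendsto (hg : g ∈ space E)
    (hfg : ∀ z, Tendsto (fun n => (f n : ℂ → ℂ) z) atTop (𝓝 (g z))) : toL2 E ⟨g, hg⟩ = v :=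
  Lp.ext ((coeFn_toL2 _).trans (ae_eq_div_of_tendsto hv hfg).symm)

variable (hE : IsHermiteBiehler E)
include hE

theorem IsHermiteBiehler.isNonposType_div_of_tendsto
    (hfg : ∀ z, Tendsto (fun n => (f n : ℂ → ℂ) z) atTop (𝓝 (g z))) :
    IsNonposType fun z => g z / E z := by
  refine isNonposType_of_cauchyInt (Lp.memLp v) (fun z hz => ?_) fun z hz => ?_
  · refine tendsto_nhds_unique (tendsto_cauchyInt hv hz.ne') ?_
    simp_rw [cauchyInt_congr (coeFn_toL2 (f _)), hE.cauchyInt_div_eq (f _).2 hz]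
    exact ((hfg z).div_const _).const_mul _
  · refine tendsto_nhds_unique (tendsto_cauchyInt hv hz.ne) ?_
    simp_rw [cauchyInt_congr (coeFn_toL2 (f _)), hE.cauchyInt_div_eq_zero (f _).2 hz]
    exact tendsto_const_nhds

theorem IsHermiteBiehler.exists_tendsto_toL2_starFn :
    ∃ v', Tendsto (fun n => toL2 E ⟨starFn (f n), starFn_mem_space hE.1 (f n).2⟩) atTop (𝓝 v') := by
  refine exists_tendsto_of_dist_eq (fun m n => ?_) hv
  rw [dist_eq_norm, dist_eq_norm, ← map_sub, ← map_sub]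
  refine norm_toL2_eq_of_ae (.of_forall fun t => ?_)
  rw [← norm_starFn_div_ofReal E (f m - f n : spaceSubmodule E)]
  simp [starFn]

theorem IsHermiteBiehler.mem_space_of_tendsto (hg : Differentiable ℂ g)
    (hfg : ∀ z, Tendsto (fun n => (f n : ℂ → ℂ) z) atTop (𝓝 (g z))) : g ∈ space E := by
  obtain ⟨v', hv'⟩ := hE.exists_tendsto_toL2_starFn hv
  exact mem_space_iff.2 ⟨hg, (memLp_congr_ae (ae_eq_div_of_tendsto hv hfg)).1 (Lp.memLp v),
    hE.isNonposType_div_of_tendsto hv hfg, hE.isNonposType_div_of_tendsto hv'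
      fun z => (continuous_conj.tendsto _).comp (hfg (conj z))⟩

end

/-! ### The reproducing kernel -/

theorem dslope_eq_integral_deriv {f : ℂ → ℂ} (hf : ContDiff ℂ 1 f) (a b : ℂ) :
    dslope f a b = ∫ s in (0 : ℝ)..1, deriv f (a + s • (b - a)) := by
  rcases eq_or_ne b a with rfl | h
  · simp
  · have : Continuous (deriv f) := hf.continuous_deriv le_rfl
    have hint := intervalIntegral.integral_unitInterval_deriv_eq_sub (f := f) (f' := deriv f)
      (z₀ := a) (z₁ := b - a) (by fun_prop)
      fun t _ => (hf.differentiable one_ne_zero _).hasDerivAt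
    rw [dslope_of_ne _ h, slope_def_module, ← add_sub_cancel a b, ← hint, add_sub_cancel,
      inv_smul_smul₀ (sub_ne_zero.2 h)]

theorem continuous_dslope_uncurry {f : ℂ → ℂ} (hf : ContDiff ℂ 1 f) :
    Continuous fun p : ℂ × ℂ => dslope f p.1 p.2 := by
  have : Continuous (deriv f) := hf.continuous_deriv le_rfl
  simp_rw [dslope_eq_integral_deriv hf]
  fun_prop

theorem kernel_of_ne {E : ℂ → ℂ} {w z : ℂ} (h : z ≠ conj w) :
    kernel E w z = kernelNum E w z / (2 * (Real.pi : ℂ) * I * (conj w - z)) := if_neg h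

theorem kernel_eq_dslope {E : ℂ → ℂ} (hE : Differentiable ℂ E) (w z : ℂ) :
    kernel E w z = -(conj (E w) * dslope E (conj w) z -
      E (conj w) * dslope (starFn E) (conj w) z) / (2 * (Real.pi : ℂ) * I) := by
  rcases eq_or_ne z (conj w) with rfl | h
  · have := ((hE _).hasDerivAt.const_mul (conj (E w))).sub
      ((differentiable_starFn hE (conj w)).hasDerivAt.const_mul (E (conj w)))
    rw [kernel, if_pos rfl, dslope_same, dslope_same, ← this.deriv]
    rfl
  · have h1 : z - conj w ≠ 0 := sub_ne_zero.2 h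
    have h2 : conj w - z ≠ 0 := sub_ne_zero.2 h.symm
    rw [kernel_of_ne h, dslope_of_ne _ h, dslope_of_ne _ h, slope_def_field, slope_def_field,
      kernelNum, starFn, starFn, conj_conj]
    have := two_pi_I_ne_zero
    field_simp
    ring

section
variable {E : ℂ → ℂ} (hE : Differentiable ℂ E)
include hE

theorem continuous_kernel_uncurry : Continuous fun p : ℂ × ℂ => kernel E p.1 p.2 := by
  have hc := hE.continuous
  have h1 := continuous_dslope_uncurry hE.contDiff
  have h2 := continuous_dslope_uncurry (differentiable_starFn hE).contDiff
  have hg : Continuous fun p : ℂ × ℂ => (conj p.1, p.2) := by fun_prop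
  simp_rw [kernel_eq_dslope hE]
  exact (((continuous_conj.comp (hc.comp continuous_fst)).mul (h1.comp hg)).sub
    ((hc.comp (continuous_conj.comp continuous_fst)).mul (h2.comp hg))).neg.div_const _

theorem differentiable_kernel (w : ℂ) : Differentiable ℂ (kernel E w) := by
  have h : ∀ f : ℂ → ℂ, Differentiable ℂ f → Differentiable ℂ (dslope f (conj w)) :=
    fun f hf => differentiableOn_univ.1
      ((Complex.differentiableOn_dslope univ_mem).2 hf.differentiableOn)
  rw [funext (kernel_eq_dslope hE w)]
  exact ((((h E hE).const_mul _).sub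
    ((h _ (differentiable_starFn hE)).const_mul _)).neg).div_const _

end

theorem eq_of_forall_ne {f g : ℂ → ℂ} (hf : Differentiable ℂ f) (hg : Differentiable ℂ g) (a : ℂ)
    (h : ∀ z, z ≠ a → f z = g z) : f = g :=
  hf.continuous.ext_on (dense_compl_singleton a) hg.continuous h

theorem starFn_kernel {E : ℂ → ℂ} (hE : Differentiable ℂ E) (w : ℂ) :
    starFn (kernel E w) = kernel E (conj w) := by
  refine eq_of_forall_ne (differentiable_starFn (differentiable_kernel hE w))
    (differentiable_kernel hE _) w fun z hz => ?_
  have h1 : conj z ≠ conj w := fun h => hz (by simpa using congrArg conj h)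
  rw [starFn, kernel_of_ne h1, kernel_of_ne (by simpa using hz)]
  have h2 : w - z ≠ 0 := sub_ne_zero.2 (Ne.symm hz)
  simp only [kernelNum, starFn, map_div₀, map_sub, map_mul, conj_conj, conj_I, conj_ofReal,
    map_ofNat]
  have hpi := ofReal_ne_zero.2 Real.pi_ne_zero
  field_simp
  ring

theorem kernel_mul {E F : ℂ → ℂ} (hE : Differentiable ℂ E) (hF : Differentiable ℂ F)
    (w : ℂ) : kernel (E * F) w =
      conj (F w) • mapI F (kernel E w) + E (conj w) • mapJ E (kernel F w) := by
  refine eq_of_forall_ne (differentiable_kernel (hE.mul hF) w) ?_ (conj w) fun z hz => ?_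
  · exact (((differentiable_kernel hE w).mul hF).const_smul _).add
      (((differentiable_kernel hF w).mul (differentiable_starFn hE)).const_smul _)
  · simp only [Pi.add_apply, Pi.smul_apply, mapI, mapJ, kernel_of_ne hz, kernelNum, starFn,
      Pi.mul_apply, smul_eq_mul, map_mul]
    ring

theorem norm_kernel_div_le {E : ℂ → ℂ} {w z : ℂ} (hne : z ≠ conj w)
    (h : ‖starFn E z / E z‖ ≤ 1) :
    ‖kernel E w z / E z‖ ≤ (‖E w‖ + ‖E (conj w)‖) * ‖(z - conj w)⁻¹‖ := by
  have hnum : ‖kernelNum E w z / E z‖ ≤ ‖E w‖ + ‖E (conj w)‖ := by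
    rw [kernelNum, sub_div, mul_div_assoc, mul_div_assoc]
    refine (norm_sub_le _ _).trans (add_le_add ?_ ?_)
    · rw [norm_mul, RCLike.norm_conj]
      exact mul_le_of_le_one_right (norm_nonneg _) (by simpa using div_self_le_one ‖E z‖)
    · rw [norm_mul]
      exact mul_le_of_le_one_right (norm_nonneg _) h
  have hn : 1 ≤ ‖(2 * (Real.pi : ℂ) * I)‖ := by
    simpa [abs_of_pos Real.pi_pos] using by linarith [Real.pi_gt_three]
  rw [kernel_of_ne hne, div_right_comm, ← div_div, norm_div _ (conj w - z), norm_sub_rev (conj w),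
    norm_inv, ← div_eq_mul_inv, norm_div _ (_ * I)]
  gcongr
  exact (div_le_self (norm_nonneg _) hn).trans hnum

theorem exists_norm_le_of_norm_le_inv_sub {φ : ℂ → ℂ} {a : ℂ} {C : ℝ}
    (hφ : ContinuousOn φ upperHalf) (ha : a.im ≠ 0)
    (h : ∀ z ∈ upperHalf, z ≠ a → ‖φ z‖ ≤ C * ‖(z - a)⁻¹‖) :
    ∃ M : ℝ, ∀ z ∈ upperHalf, ‖φ z‖ ≤ M := by
  have hr : 0 < |a.im| := abs_pos.2 ha
  have hfar : ∀ z ∈ upperHalf, |a.im| / 2 ≤ ‖z - a‖ → ‖φ z‖ ≤ |C| * (2 / |a.im|) :=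
    fun z hz hza => by
      have hne : z ≠ a := by
        rintro rfl
        rw [sub_self, norm_zero] at hza
        linarith
      refine (h z hz hne).trans (mul_le_mul (le_abs_self C) ?_ (norm_nonneg _) (abs_nonneg C))
      rw [norm_inv, ← inv_div]
      exact inv_anti₀ (by positivity) hza
  have hball : ∀ z ∈ closedBall a (|a.im| / 2), |z.im - a.im| ≤ |a.im| / 2 := fun z hz => by
    rw [← sub_im]
    exact (abs_im_le_norm _).trans (mem_closedBall_iff_norm.1 hz)
  obtain ⟨B, hB⟩ : ∃ B, ∀ z ∈ upperHalf, ‖z - a‖ ≤ |a.im| / 2 → ‖φ z‖ ≤ B := by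
    rcases lt_or_gt_of_ne ha with hneg | hpos
    · refine ⟨0, fun z (hz : 0 < z.im) hza => ?_⟩
      have := (abs_le.1 (hball z (mem_closedBall_iff_norm.2 hza))).2
      rw [abs_of_neg hneg] at this
      linarith
    · have hsub : closedBall a (|a.im| / 2) ⊆ upperHalf := fun z hz => by
        have := (abs_le.1 (hball z hz)).1
        rw [abs_of_pos hpos] at this
        change 0 < z.im
        linarith
      obtain ⟨B, hB⟩ := (isCompact_closedBall a _).exists_bound_of_continuousOn (hφ.mono hsub)
      exact ⟨B, fun z _ hza => hB z (mem_closedBall_iff_norm.2 hza)⟩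
  refine ⟨max (|C| * (2 / |a.im|)) B, fun z hz => ?_⟩
  rcases le_total (|a.im| / 2) ‖z - a‖ with hza | hza
  · exact (hfar z hz hza).trans (le_max_left _ _)
  · exact (hB z hz hza).trans (le_max_right _ _)

section
variable {E : ℂ → ℂ} (hE : IsHermiteBiehler E) {w : ℂ}
include hE

theorem IsHermiteBiehler.isNonposType_kernel_div (hw : w.im ≠ 0) :
    IsNonposType fun z => kernel E w z / E z := by
  have hd := hE.differentiableOn_div (differentiable_kernel hE.1 w)
  exact isNonposType_of_bounded hd (exists_norm_le_of_norm_le_inv_sub hd.continuousOn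
    (a := conj w) (by simpa using hw)
    fun z hz hne => norm_kernel_div_le hne (hE.norm_starFn_div_le hz))

theorem IsHermiteBiehler.memLp_kernel_div (hw : w.im ≠ 0) :
    MemLp (fun t : ℝ => kernel E w t / E t) 2 := by
  have hwc : (conj w).im ≠ 0 := by simpa using hw
  refine ((memLp_inv_ofReal_sub hwc).const_mul ((‖E w‖ + ‖E (conj w)‖ : ℝ) : ℂ)).of_le
    (aestronglyMeasurable_div hE.1 (differentiable_kernel hE.1 w)) (.of_forall fun t => ?_)
  rw [norm_mul, norm_real, Real.norm_of_nonneg (by positivity)]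
  refine norm_kernel_div_le (sub_ne_zero.1 (ofReal_sub_ne_zero hwc t)) ?_
  rw [norm_starFn_div_ofReal, norm_div]
  exact div_self_le_one _

theorem IsHermiteBiehler.kernel_mem_space_of_im_ne_zero (hw : w.im ≠ 0) :
    kernel E w ∈ space E := by
  refine mem_space_iff.2 ⟨differentiable_kernel hE.1 w, hE.memLp_kernel_div hw,
    hE.isNonposType_kernel_div hw, ?_⟩
  rw [starFn_kernel hE.1]
  exact hE.isNonposType_kernel_div (by simpa using hw)

end

theorem cauchyInt_conj (φ : ℝ → ℂ) (z : ℂ) :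
    cauchyInt (fun t => conj (φ t)) z = conj (cauchyInt φ (conj z)) := by
  rw [cauchyInt, cauchyInt, ← integral_conj]
  exact integral_congr_ae (.of_forall fun t => by simp)

section
variable {E f : ℂ → ℂ} (hE : IsHermiteBiehler E) (hf : f ∈ space E) {w : ℂ} (hw : w.im ≠ 0)
include hE hf hw

theorem IsHermiteBiehler.ip_kernel_eq_cauchyInt :
    ip E f (kernel E w) = (2 * (Real.pi : ℂ) * I)⁻¹ *
      (E w * cauchyInt (fun t => f t / E t) w -
        starFn E w * conj (cauchyInt (fun t => starFn f t / E t) (conj w))) := by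
  have hi1 := integrable_div_ofReal_sub hf.2.1 hw
  have hLs : MemLp (fun t : ℝ => conj (starFn f t / E t)) 2 := (starFn_mem_space hE.1 hf).2.1.star
  have hi2 := integrable_div_ofReal_sub hLs hw
  rw [← cauchyInt_conj, ip_eq_integral, cauchyInt, cauchyInt, ← integral_const_mul,
    ← integral_const_mul, ← integral_sub (hi1.const_mul _) (hi2.const_mul _),
    ← integral_const_mul]
  refine integral_congr_ae ?_
  filter_upwards [hE.ae_ne_zero] with t ht
  have h1 := ofReal_sub_ne_zero hw t
  have h2 : w - t ≠ 0 := sub_ne_zero.2 (sub_ne_zero.1 h1).symm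
  have h3 : conj (E t) ≠ 0 := by simpa using ht
  have hpi := ofReal_ne_zero.2 Real.pi_ne_zero
  simp only [kernel_of_ne (sub_ne_zero.1 (ofReal_sub_ne_zero (z := conj w) (by simpa using hw) t)),
    kernelNum, starFn, map_div₀, map_sub, map_mul, conj_conj, conj_I, conj_ofReal, map_ofNat]
  field_simp
  ring

theorem IsHermiteBiehler.apply_eq_ip_kernel_of_im_ne_zero : f w = ip E f (kernel E w) := by
  have hfs := starFn_mem_space hE.1 hf
  have hpi := ofReal_ne_zero.2 Real.pi_ne_zero
  rw [hE.ip_kernel_eq_cauchyInt hf hw]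
  rcases lt_or_gt_of_ne hw with hneg | hpos
  · have hwc : 0 < (conj w).im := by simpa using hneg
    have hE1 : conj (E (conj w)) ≠ 0 := by simpa using hE.ne_zero hwc
    rw [hE.cauchyInt_div_eq_zero hf hneg, hE.cauchyInt_div_eq hfs hwc]
    simp only [starFn, map_div₀, map_mul, conj_conj, conj_I, conj_ofReal, map_ofNat]
    field_simp
    ring
  · have hE0 := hE.ne_zero hpos
    rw [hE.cauchyInt_div_eq hf hpos, hE.cauchyInt_div_eq_zero hfs (by simpa using hpos)]
    simp only [map_zero, mul_zero, sub_zero]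
    field_simp

end

theorem cauchySeq_of_tendsto_inner {𝕜 X : Type*} [RCLike 𝕜] [SeminormedAddCommGroup X]
    [InnerProductSpace 𝕜 X] {u : ℕ → X} {c : 𝕜}
    (h : Tendsto (fun p : ℕ × ℕ => inner 𝕜 (u p.1) (u p.2)) atTop (𝓝 c)) : CauchySeq u := by
  have hre := (RCLike.continuous_re.tendsto c).comp h
  rw [← prod_atTop_atTop_eq] at hre
  have hlim := ((hre.comp (tendsto_fst.prodMk tendsto_fst)).sub (hre.const_mul 2)).add
    (hre.comp (tendsto_snd.prodMk tendsto_snd))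
  rw [prod_atTop_atTop_eq] at hlim
  refine cauchySeq_iff_tendsto_dist_atTop_0.2 ?_
  have hsq : ∀ p : ℕ × ℕ, dist (u p.1) (u p.2) = √(RCLike.re (inner 𝕜 (u p.1) (u p.1)) -
      2 * RCLike.re (inner 𝕜 (u p.1) (u p.2)) + RCLike.re (inner 𝕜 (u p.2) (u p.2))) := fun p => by
    rw [inner_self_eq_norm_sq, inner_self_eq_norm_sq, ← norm_sub_sq, Real.sqrt_sq (norm_nonneg _),
      dist_eq_norm]
  simp_rw [hsq]
  have := (Real.continuous_sqrt.tendsto _).comp hlim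
  rwa [show RCLike.re c - 2 * RCLike.re c + RCLike.re c = 0 by ring, Real.sqrt_zero] at this

theorem exists_seq_im_ne_zero_tendsto (w : ℂ) :
    ∃ u : ℕ → ℂ, (∀ n, (u n).im ≠ 0) ∧ Tendsto u atTop (𝓝 w) :=
  mem_closure_iff_seq_limit.1 ((dense_compl_singleton (0 : ℝ)).preimage isOpenMap_im w)

/-- At a real point the kernel is the limit of kernels at nonreal points, where Cauchy's formula
applies. -/
theorem IsHermiteBiehler.isReproducingKernel_kernel {E : ℂ → ℂ} (hE : IsHermiteBiehler E) :
    IsReproducingKernel E (kernel E) := by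
  intro w
  obtain ⟨u, hu, huw⟩ := exists_seq_im_ne_zero_tendsto w
  let k (n : ℕ) : spaceSubmodule E := ⟨kernel E (u n), hE.kernel_mem_space_of_im_ne_zero (hu n)⟩
  have hrep (f : spaceSubmodule E) (n : ℕ) :
      inner ℂ (toL2 E (k n)) (toL2 E f) = (f : ℂ → ℂ) (u n) := by
    rw [inner_toL2, hE.apply_eq_ip_kernel_of_im_ne_zero f.2 (hu n)]
  have hK := continuous_kernel_uncurry hE.1
  have hcauchy : CauchySeq fun n => toL2 E (k n) := by
    refine cauchySeq_of_tendsto_inner (𝕜 := ℂ) (c := kernel E w w) ?_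
    simp_rw [hrep, ← prod_atTop_atTop_eq]
    exact (hK.tendsto (w, w)).comp ((huw.comp tendsto_snd).prodMk_nhds (huw.comp tendsto_fst))
  obtain ⟨v, hv⟩ := cauchySeq_tendsto_of_complete hcauchy
  have hlim : ∀ z, Tendsto (fun n => (k n : ℂ → ℂ) z) atTop (𝓝 (kernel E w z)) := fun z =>
    (hK.tendsto (w, z)).comp (huw.prodMk_nhds tendsto_const_nhds)
  have hmem := hE.mem_space_of_tendsto hv (differentiable_kernel hE.1 w) hlim
  refine ⟨hmem, fun f hf => ?_⟩
  have hfw : Tendsto (fun n => f (u n)) atTop (𝓝 (f w)) := (hf.1.continuous.tendsto w).comp huw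
  have hip : Tendsto (fun n => f (u n)) atTop (𝓝 (inner ℂ v (toL2 E ⟨f, hf⟩))) :=
    (hv.inner tendsto_const_nhds).congr (hrep ⟨f, hf⟩)
  rw [tendsto_nhds_unique hfw hip, ← toL2_eq_of_tendsto hv hmem hlim, inner_toL2]

/-! ### Completeness of the de Branges space -/

section

variable {E : ℂ → ℂ} (hE : IsHermiteBiehler E)

/-- The reproducing kernel `K_E(w, ·)` as an element of `H(E)`. -/
def kernelElt (w : ℂ) : spaceSubmodule E :=
  ⟨kernel E w, (hE.isReproducingKernel_kernel w).1⟩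

theorem inner_kernelElt (w : ℂ) (f : spaceSubmodule E) :
    inner ℂ (toL2 E (kernelElt hE w)) (toL2 E f) = (f : ℂ → ℂ) w := by
  rw [inner_toL2]
  exact ((hE.isReproducingKernel_kernel w).2 f f.2).symm

include hE

theorem toL2_injective : Function.Injective (toL2 E) := by
  refine (injective_iff_map_eq_zero _).2 fun f h => Subtype.ext (funext fun w => ?_)
  rw [← inner_kernelElt hE, h, inner_zero_right]
  rfl

theorem continuous_norm_kernelElt : Continuous fun w => ‖toL2 E (kernelElt hE w)‖ := by
  have hK : Continuous fun w => kernel E w w :=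
    (continuous_kernel_uncurry hE.1).comp (continuous_id.prodMk continuous_id)
  simp_rw [norm_eq_sqrt_re_inner (𝕜 := ℂ), inner_kernelElt hE]
  exact (continuous_re.comp hK).sqrt

end

theorem tendstoLocallyUniformly_inner {𝕜 X α ι : Type*} [RCLike 𝕜] [SeminormedAddCommGroup X]
    [InnerProductSpace 𝕜 X] [TopologicalSpace α] {k : α → X} (hk : Continuous fun a => ‖k a‖)
    {l : Filter ι} {u : ι → X} {v : X} (hv : Tendsto u l (𝓝 v)) :
    TendstoLocallyUniformly (fun i a => inner 𝕜 (k a) (u i)) (fun a => inner 𝕜 (k a) v) l := by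
  refine Metric.tendstoLocallyUniformly_iff.2 fun ε hε a => ?_
  have hC : 0 < ‖k a‖ + 1 := by positivity
  refine ⟨{b | ‖k b‖ < ‖k a‖ + 1}, hk.continuousAt.eventually_lt_const (lt_add_one _), ?_⟩
  filter_upwards [Metric.tendsto_nhds.1 hv _ (div_pos hε hC)] with i hi b hb
  rw [dist_eq_norm, ← inner_sub_right]
  calc ‖inner 𝕜 (k b) (v - u i)‖ ≤ ‖k b‖ * ‖v - u i‖ := norm_inner_le_norm _ _
    _ ≤ (‖k a‖ + 1) * ‖v - u i‖ := by gcongr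
    _ < ε := by rwa [mul_comm, ← lt_div_iff₀ hC, ← dist_eq_norm, dist_comm]

theorem isClosed_range_toL2 {E : ℂ → ℂ} (hE : IsHermiteBiehler E) :
    IsClosed (LinearMap.range (toL2 E) : Set (Lp ℂ 2 (volume : Measure ℝ))) := by
  refine IsSeqClosed.isClosed fun u v hu hv => ?_
  choose f hf using hu
  obtain rfl : (fun n => toL2 E (f n)) = u := funext hf
  have hunif := tendstoLocallyUniformly_inner (𝕜 := ℂ) (continuous_norm_kernelElt hE) hv
  simp_rw [inner_kernelElt hE] at hunif
  have hg := (tendstoLocallyUniformlyOn_univ.2 hunif).differentiableOn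
    (.of_forall fun n => (f n).2.1.differentiableOn) isOpen_univ
  have hlim := fun z => tendstoLocallyUniformlyOn_univ.2 hunif |>.tendsto_at (mem_univ z)
  have hmem := hE.mem_space_of_tendsto hv (differentiableOn_univ.1 hg) hlim
  exact ⟨⟨_, hmem⟩, toL2_eq_of_tendsto hv hmem hlim⟩

theorem isClosed_range_of_norm_eq {R V X Y : Type*} [Ring R] [AddCommGroup V] [Module R V]
    [NormedAddCommGroup X] [Module R X] [CompleteSpace X] [NormedAddCommGroup Y] [Module R Y]
    {A : V →ₗ[R] X} {B : V →ₗ[R] Y} (h : ∀ v, ‖A v‖ = ‖B v‖)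
    (hA : IsClosed (LinearMap.range A : Set X)) : IsClosed (LinearMap.range B : Set Y) := by
  have hdist : ∀ v w, dist (A v) (A w) = dist (B v) (B w) := fun v w => by
    rw [dist_eq_norm, dist_eq_norm, ← map_sub, ← map_sub, h]
  refine IsSeqClosed.isClosed fun u y hu hy => ?_
  choose v hv using hu
  obtain rfl : (fun n => B (v n)) = u := funext hv
  obtain ⟨x, hx⟩ := exists_tendsto_of_dist_eq (fun m n => hdist (v m) (v n)) hy
  obtain ⟨a, rfl⟩ := hA.mem_of_tendsto hx (.of_forall fun n => ⟨v n, rfl⟩)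
  refine ⟨a, tendsto_nhds_unique (tendsto_iff_dist_tendsto_zero.2 ?_) hy⟩
  simpa only [hdist] using tendsto_iff_dist_tendsto_zero.1 hx

theorem exists_inner_sub_eq_zero {𝕜 V X : Type*} [RCLike 𝕜] [AddCommGroup V] [Module 𝕜 V]
    [NormedAddCommGroup X] [InnerProductSpace 𝕜 X] [CompleteSpace X] {T : V →ₗ[𝕜] X}
    (hT : IsClosed (LinearMap.range T : Set X)) (u : X) :
    ∃ r, ∀ a, inner 𝕜 (T a) (u - T r) = 0 := by
  have : CompleteSpace (LinearMap.range T) := hT.completeSpace_coe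
  obtain ⟨r, hr⟩ := ((LinearMap.range T).orthogonalProjectionOnto u).2
  refine ⟨r, fun a => ?_⟩
  rw [hr]
  exact Submodule.sub_starProjection_mem_orthogonal u _ ⟨a, rfl⟩

theorem eq_zero_of_eqOn_upperHalf {f : ℂ → ℂ} (hf : Differentiable ℂ f)
    (h : ∀ z ∈ upperHalf, f z = 0) : f = 0 :=
  AnalyticOnNhd.eq_of_eventuallyEq (fun z _ => hf.analyticAt z) (fun _ _ => analyticAt_const)
    (mem_of_superset (isOpen_upperHalf.mem_nhds I_mem_upperHalf) h)

theorem inner_toL2_eq_zero_of_kernelElt {E : ℂ → ℂ} (hE : IsHermiteBiehler E)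
    {u : Lp ℂ 2 (volume : Measure ℝ)}
    (hu : ∀ w ∈ upperHalf, inner ℂ (toL2 E (kernelElt hE w)) u = 0) (f : spaceSubmodule E) :
    inner ℂ (toL2 E f) u = 0 := by
  obtain ⟨r, hr⟩ := exists_inner_sub_eq_zero (isClosed_range_toL2 hE) u
  have hr0 : r = 0 := Subtype.ext (eq_zero_of_eqOn_upperHalf r.2.1 fun w hw => by
    have h := hr (kernelElt hE w)
    rwa [inner_sub_right, hu w hw, zero_sub, neg_eq_zero, inner_kernelElt] at h)
  simpa [hr0] using hr f

/-! ### The decomposition of `H(EF)` -/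

section

variable {E F : ℂ → ℂ}

theorem IsHermiteBiehler.mapI_div_ae_eq (hF : IsHermiteBiehler F) (f : ℂ → ℂ) :
    (fun t : ℝ => mapI F f t / (E * F) t) =ᵐ[volume] fun t : ℝ => f t / E t := by
  filter_upwards [hF.ae_ne_zero] with t ht
  rw [mapI, Pi.mul_apply, mul_div_mul_right _ _ ht]

theorem IsHermiteBiehler.mapI_mem_space (hF : IsHermiteBiehler F) {f : ℂ → ℂ} (hf : f ∈ space E) :
    mapI F f ∈ space (E * F) := by
  rw [mem_space_iff] at hf ⊢
  refine ⟨hf.1.mul hF.1, (memLp_congr_ae (hF.mapI_div_ae_eq f)).2 hf.2.1,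
    hf.2.2.1.congr fun z hz => ?_, (hF.isNonposType_mul_starFn_div hf.2.2.2).congr fun z _ => ?_⟩
  · simp only [mapI, Pi.mul_apply, mul_div_mul_right _ _ (hF.ne_zero hz)]
  · simp only [mapI, Pi.mul_apply, starFn, map_mul, div_mul_div_comm]

theorem IsHermiteBiehler.ip_mapI (hF : IsHermiteBiehler F) (f₁ f₂ : ℂ → ℂ) :
    ip (E * F) (mapI F f₁) (mapI F f₂) = ip E f₁ f₂ := by
  rw [ip_eq_integral, ip_eq_integral]
  refine integral_congr_ae ?_
  filter_upwards [hF.mapI_div_ae_eq (E := E) f₁, hF.mapI_div_ae_eq (E := E) f₂] with t h1 h2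
  rw [h1, h2]

theorem mapJ_div_ofReal (E F g : ℂ → ℂ) (t : ℝ) :
    mapJ E g t / (E * F) t = g t / F t * (conj (E t) / E t) := by
  rw [mapJ, Pi.mul_apply, starFn_ofReal, div_mul_div_comm, mul_comm (E t)]

theorem IsHermiteBiehler.mapJ_mem_space (hE : IsHermiteBiehler E) (hF : Differentiable ℂ F)
    {g : ℂ → ℂ} (hg : g ∈ space F) : mapJ E g ∈ space (E * F) := by
  rw [mem_space_iff] at hg ⊢
  have hd : Differentiable ℂ (mapJ E g) := hg.1.mul (differentiable_starFn hE.1)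
  refine ⟨hd, hg.2.1.of_le (aestronglyMeasurable_div (hE.1.mul hF) hd) (.of_forall fun t => ?_),
    (hE.isNonposType_mul_starFn_div hg.2.2.1).congr fun z _ => ?_,
    hg.2.2.2.congr fun z hz => ?_⟩
  · rw [mapJ_div_ofReal, norm_mul, norm_div (conj _), RCLike.norm_conj]
    exact mul_le_of_le_one_right (norm_nonneg _) (div_self_le_one _)
  · simp only [mapJ, Pi.mul_apply, div_mul_div_comm, mul_comm (F z)]
  · simp only [mapJ, Pi.mul_apply, starFn, map_mul, conj_conj]
    rw [mul_comm (E z), mul_div_mul_right _ _ (hE.ne_zero hz)]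

theorem IsHermiteBiehler.ip_mapJ (hE : IsHermiteBiehler E) (g₁ g₂ : ℂ → ℂ) :
    ip (E * F) (mapJ E g₁) (mapJ E g₂) = ip F g₁ g₂ := by
  rw [ip_eq_integral, ip_eq_integral]
  refine integral_congr_ae ?_
  filter_upwards [hE.ae_ne_zero] with t ht
  have ht' : conj (E t) ≠ 0 := by simpa using ht
  rw [mapJ_div_ofReal, mapJ_div_ofReal]
  simp only [map_mul, map_div₀, conj_conj]
  field_simp

/-- The map `mapI F`, multiplication by `F`, as a linear map `H(E) → H(EF)`. -/
def mapILin (hF : IsHermiteBiehler F) : spaceSubmodule E →ₗ[ℂ] spaceSubmodule (E * F) where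
  toFun f := ⟨mapI F f, hF.mapI_mem_space f.2⟩
  map_add' _ _ := Subtype.ext (funext fun _ => add_mul _ _ _)
  map_smul' _ _ := Subtype.ext (funext fun _ => mul_assoc _ _ _)

variable (hE : IsHermiteBiehler E) (hF : IsHermiteBiehler F)

/-- The map `mapJ E`, multiplication by `E*`, as a linear map `H(F) → H(EF)`. -/
def mapJLin : spaceSubmodule F →ₗ[ℂ] spaceSubmodule (E * F) where
  toFun g := ⟨mapJ E g, hE.mapJ_mem_space hF.1 g.2⟩
  map_add' _ _ := Subtype.ext (funext fun _ => add_mul _ _ _)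
  map_smul' _ _ := Subtype.ext (funext fun _ => mul_assoc _ _ _)

theorem toL2_mapILin (f : spaceSubmodule E) : toL2 (E * F) (mapILin hF f) = toL2 E f :=
  Lp.ext ((coeFn_toL2 _).trans ((hF.mapI_div_ae_eq f).trans (coeFn_toL2 f).symm))

theorem inner_toL2_mapJLin (g₁ g₂ : spaceSubmodule F) :
    inner ℂ (toL2 (E * F) (mapJLin hE hF g₁)) (toL2 (E * F) (mapJLin hE hF g₂)) =
      inner ℂ (toL2 F g₁) (toL2 F g₂) := by
  rw [inner_toL2, inner_toL2]
  exact hE.ip_mapJ _ _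

theorem norm_toL2_mapJLin (g : spaceSubmodule F) :
    ‖toL2 (E * F) (mapJLin hE hF g)‖ = ‖toL2 F g‖ := by
  rw [norm_eq_sqrt_re_inner (𝕜 := ℂ), inner_toL2_mapJLin, ← norm_eq_sqrt_re_inner]

theorem inner_kernelElt_mul (w : ℂ) (u : Lp ℂ 2 (volume : Measure ℝ)) :
    inner ℂ (toL2 (E * F) (kernelElt (hE.mul hF) w)) u =
      F w * inner ℂ (toL2 E (kernelElt hE w)) u +
        conj (E (conj w)) * inner ℂ (toL2 (E * F) (mapJLin hE hF (kernelElt hF w))) u := by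
  have hk : kernelElt (hE.mul hF) w = conj (F w) • mapILin hF (kernelElt hE w) +
      E (conj w) • mapJLin hE hF (kernelElt hF w) := Subtype.ext (kernel_mul hE.1 hF.1 w)
  rw [hk, map_add, map_smul, map_smul, inner_add_left, inner_smul_left, inner_smul_left,
    toL2_mapILin, conj_conj]

/-- Both sides of the reproducing formula for `J g` at `w` contain `E*(w) g(w)`; what remains is
`F(w)` times the inner product. -/
theorem inner_kernelElt_mapJLin (g : spaceSubmodule F) {w : ℂ} (hw : w ∈ upperHalf) :
    inner ℂ (toL2 E (kernelElt hE w)) (toL2 (E * F) (mapJLin hE hF g)) = 0 := by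
  have h1 := inner_kernelElt_mul hE hF w (toL2 (E * F) (mapJLin hE hF g))
  have h2 : ((mapJLin hE hF g : spaceSubmodule (E * F)) : ℂ → ℂ) w =
      conj (E (conj w)) * (g : ℂ → ℂ) w := mul_comm _ _
  rw [inner_kernelElt, inner_toL2_mapJLin, inner_kernelElt, h2, right_eq_add] at h1
  exact (mul_eq_zero.1 h1).resolve_left (hF.ne_zero hw)

theorem inner_toL2_mapJLin_eq_zero (f : spaceSubmodule E) (g : spaceSubmodule F) :
    inner ℂ (toL2 E f) (toL2 (E * F) (mapJLin hE hF g)) = 0 :=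
  inner_toL2_eq_zero_of_kernelElt hE (fun _ hw => inner_kernelElt_mapJLin hE hF g hw) f

include hE hF in
theorem ip_mapI_mapJ {f g : ℂ → ℂ} (hf : f ∈ space E) (hg : g ∈ space F) :
    ip (E * F) (mapI F f) (mapJ E g) = 0 := by
  have h := inner_eq_zero_symm.1 (inner_toL2_mapJLin_eq_zero hE hF ⟨f, hf⟩ ⟨g, hg⟩)
  rwa [← toL2_mapILin hF ⟨f, hf⟩, inner_toL2] at h

theorem surjective_coprod_mapILin_mapJLin :
    Function.Surjective ((mapILin hF).coprod (mapJLin hE hF)) := by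
  intro h
  set u := toL2 (E * F) h
  obtain ⟨f, hf⟩ := exists_inner_sub_eq_zero (isClosed_range_toL2 hE) u
  obtain ⟨g, hg⟩ := exists_inner_sub_eq_zero
    (isClosed_range_of_norm_eq (B := toL2 (E * F) ∘ₗ mapJLin hE hF)
      (fun g => (norm_toL2_mapJLin hE hF g).symm) (isClosed_range_toL2 hF)) u
  simp only [LinearMap.comp_apply] at hg
  set d := h - (mapILin hF f + mapJLin hE hF g)
  have hd : toL2 (E * F) d = u - toL2 E f - toL2 (E * F) (mapJLin hE hF g) := by
    rw [map_sub, map_add, toL2_mapILin, ← sub_sub]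
  have hI (a : spaceSubmodule E) : inner ℂ (toL2 E a) (toL2 (E * F) d) = 0 := by
    rw [hd, inner_sub_right, hf, inner_toL2_mapJLin_eq_zero, sub_zero]
  have hJ (a : spaceSubmodule F) :
      inner ℂ (toL2 (E * F) (mapJLin hE hF a)) (toL2 (E * F) d) = 0 := by
    rw [hd, sub_right_comm, inner_sub_right, hg,
      inner_eq_zero_symm.1 (inner_toL2_mapJLin_eq_zero hE hF f a), sub_zero]
  have hd0 : d = 0 := Subtype.ext (funext fun w => by
    rw [← inner_kernelElt (hE.mul hF), inner_kernelElt_mul hE hF, hI, hJ, mul_zero,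
      mul_zero, add_zero]
    rfl)
  exact ⟨(f, g), (sub_eq_zero.1 hd0).symm⟩

theorem injective_coprod_mapILin_mapJLin :
    Function.Injective ((mapILin hF).coprod (mapJLin hE hF)) := by
  refine (injective_iff_map_eq_zero _).2 fun ⟨f, g⟩ h => ?_
  rw [LinearMap.coprod_apply] at h
  have hsum : toL2 E f + toL2 (E * F) (mapJLin hE hF g) = 0 := by
    rw [← toL2_mapILin hF, ← map_add, h, map_zero]
  have hf : toL2 E f = 0 := by
    have := congrArg (inner ℂ (toL2 E f)) hsum
    rwa [inner_add_right, inner_toL2_mapJLin_eq_zero, inner_zero_right, add_zero,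
      inner_self_eq_zero] at this
  have hg : toL2 F g = 0 := by
    rw [hf, zero_add] at hsum
    rw [← norm_eq_zero, ← norm_toL2_mapJLin hE hF, hsum, norm_zero]
  exact Prod.ext (toL2_injective hE (hf.trans (map_zero _).symm))
    (toL2_injective hF (hg.trans (map_zero _).symm))

end

end DeBranges

end

theorem lemmaL (E F : ℂ → ℂ) (hE : DeBranges.IsHermiteBiehler E)
    (hF : DeBranges.IsHermiteBiehler F) :
    -- `I : H(E) → H(EF)` and `J : H(F) → H(EF)` are well defined and isometric
    (∀ f ∈ DeBranges.space E, DeBranges.mapI F f ∈ DeBranges.space (E * F)) ∧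
    (∀ f₁ ∈ DeBranges.space E, ∀ f₂ ∈ DeBranges.space E,
      DeBranges.ip (E * F) (DeBranges.mapI F f₁) (DeBranges.mapI F f₂) = DeBranges.ip E f₁ f₂) ∧
    (∀ g ∈ DeBranges.space F, DeBranges.mapJ E g ∈ DeBranges.space (E * F)) ∧
    (∀ g₁ ∈ DeBranges.space F, ∀ g₂ ∈ DeBranges.space F,
      DeBranges.ip (E * F) (DeBranges.mapJ E g₁) (DeBranges.mapJ E g₂) = DeBranges.ip F g₁ g₂) ∧
    -- their images are orthogonal in `H(EF)`
    (∀ f ∈ DeBranges.space E, ∀ g ∈ DeBranges.space F,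
      DeBranges.ip (E * F) (DeBranges.mapI F f) (DeBranges.mapJ E g) = 0) ∧
    -- together they span `H(EF)`, with unique components
    (∀ h : ℂ → ℂ, h ∈ DeBranges.space (E * F) ↔
      ∃! p : (ℂ → ℂ) × (ℂ → ℂ), p.1 ∈ DeBranges.space E ∧ p.2 ∈ DeBranges.space F ∧
        h = DeBranges.mapI F p.1 + DeBranges.mapJ E p.2) ∧
    -- the reproducing kernels and the kernel identity
    DeBranges.IsReproducingKernel E (DeBranges.kernel E) ∧
    DeBranges.IsReproducingKernel F (DeBranges.kernel F) ∧
    DeBranges.IsReproducingKernel (E * F) (DeBranges.kernel (E * F)) ∧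
    (∀ w : ℂ, DeBranges.kernel (E * F) w =
      conj (F w) • DeBranges.mapI F (DeBranges.kernel E w) +
        E (conj w) • DeBranges.mapJ E (DeBranges.kernel F w)) := by
  open DeBranges in
  refine ⟨fun f hf => hF.mapI_mem_space hf, fun f₁ _ f₂ _ => hF.ip_mapI f₁ f₂,
    fun g hg => hE.mapJ_mem_space hF.1 hg, fun g₁ _ g₂ _ => hE.ip_mapJ g₁ g₂,
    fun f hf g hg => ip_mapI_mapJ hE hF hf hg, fun h => ⟨fun hh => ?_, ?_⟩,
    hE.isReproducingKernel_kernel, hF.isReproducingKernel_kernel,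
    (hE.mul hF).isReproducingKernel_kernel, kernel_mul hE.1 hF.1⟩
  · obtain ⟨⟨f, g⟩, hfg⟩ := surjective_coprod_mapILin_mapJLin hE hF ⟨h, hh⟩
    refine ⟨(f, g), ⟨f.2, g.2, (congrArg Subtype.val hfg).symm⟩, ?_⟩
    rintro ⟨f', g'⟩ ⟨hf', hg', hh'⟩
    have hfg' : (mapILin hF).coprod (mapJLin hE hF) (⟨f', hf'⟩, ⟨g', hg'⟩) = ⟨h, hh⟩ :=
      Subtype.ext hh'.symm
    have heq := injective_coprod_mapILin_mapJLin hE hF (hfg'.trans hfg.symm)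
    exact congrArg (Prod.map Subtype.val Subtype.val) heq
  · rintro ⟨⟨f, g⟩, ⟨hf, hg, rfl⟩, -⟩
    exact add_mem_space (hF.mapI_mem_space hf) (hE.mapJ_mem_space hF.1 hg)
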